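/- Let $K,\gamma\in(0,\infty)$ and, for each $n\in\mathbb N$, let $N=N(n)$ and $M=M(n)$ be positive integers with $M\le N$. Suppose that the following hold for all $n$ (the random matrices being defined on one probability space). **A1.** $\Sigma_n=\mathbf U_n\,\mathrm{diag}(l^{(n)}_1,\dots,l^{(n)}_M,1,\dots,1)\,\mathbf U_n^T\in\mathbb R^{N\times N}$ is deterministic, with $l^{(n)}_1\ge l^{(n)}_2\ge\dots\ge l^{(n)}_M\ge 1$ and $\mathbf U_n=[u^{(n)}_1\ \dots\ u^{(n)}_N]$ orthogonal. **A2.** $\mathbf X_n=\mathbf U_n\,\mathrm{diag}\big(\sqrt{l^{(n)}_1},\dots,\sqrt{l^{(n)}_M},1,\dots,1\big)\,\mathbf Z_n\in\mathbb R^{N\times n}$, where the entries of $\mathbf Z_n=(z^{(n)}_{ij})\in\mathbb R^{N\times n}$ are i.i.d. subgaussian random variables with $\mathbb E[z^{(n)}_{11}]=0$, $\mathbb E[(z^{(n)}_{11})^2]=1$ and $\|z^{(n)}_{11}\|_{\psi_2}\le K$; here $\|Y\|_{\psi_2}=\inf\{t>0:\mathbb E[\exp(Y^2/t^2)]\le 2\}$.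 (Their law may depend on $n$, and nothing is assumed about the joint law of the matrices $\mathbf Z_n$ for different $n$.) **A3.** $\frac1\gamma\le\frac{N}{n}\le\gamma$. **A4.** $\lim_{n\to\infty}\frac{M(n)}{n}=0$. Let $\mathbf S_n=\frac1n\mathbf X_n\mathbf X_n^T$ be the sample covariance matrix, let $\hat l^{(n)}_1\ge\dots\ge\hat l^{(n)}_M$ be its $M$ largest eigenvalues (with multiplicity), and let $p^{(n)}_1,\dots,p^{(n)}_M$ be any corresponding linearly independent unit eigenvectors. Suppose moreover that for some $\nu(n)\in\{1,2,\dots,M(n)\}$, $n\in\mathbb N$, and some $\epsilon_0>0$, $$\liminf_{n\to\infty}\frac{l^{(n)}_{\nu(n)}}{l^{(n)}_{\nu(n)+1}}>1+\epsilon_0,\qquad \liminf_{n\to\infty}\frac{l^{(n)}_{\nu(n)-1}}{l^{(n)}_{\nu(n)}}>1+\epsilon_0,\qquad \lim_{n\to\infty}l^{(n)}_{\nu(n)}=\infty,$$ where by convention $l^{(n)}_{M(n)+1}=1$ and $l^{(n)}_0=+\infty$ (the liminfs are taken in $[0,\infty]$). Then, as $n\to\infty$, $$\big\langle p^{(n)}_{\nu(n)},u^{(n)}_{\nu(n)}\big\rangle^2\to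 1\quad\text{almost surely}.$$ -/

import Mathlib

open MeasureTheory ProbabilityTheory Filter Topology
open scoped ENNReal Matrix

/-- The norm `‖Y‖_ψ₂ = inf {t > 0 : 𝔼[exp (Y² / t²)] ≤ 2}` of a real random variable,
with values in `[0, ∞]`; it is `∞` exactly when no such `t` exists, that is, when `Y` is not
subgaussian. -/
noncomputable def psiTwoNorm {Ω : Type*} [MeasurableSpace Ω] (P : Measure Ω) (Y : Ω → ℝ) :
    ℝ≥0∞ :=
  ⨅ (t : ℝ) (_ : 0 < t ∧ ∫⁻ ω, ENNReal.ofReal (Real.exp (Y ω ^ 2 / t ^ 2)) ∂P ≤ 2),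
    ENNReal.ofReal t

/-- The vector `(l₁, …, l_M, 1, …, 1)` of length `N`. -/
noncomputable def spikedSpectrum {M : ℕ} (N : ℕ) (l : Fin M → ℝ) : Fin N → ℝ :=
  fun i => if h : (i : ℕ) < M then l ⟨i, h⟩ else 1

/-- `Sigma = U diag(l₁, …, l_M, 1, …, 1) Uᵀ` with `U` orthogonal and `l₁ ≥ … ≥ l_M ≥ 1`. -/
structure IsSpikedCovariance {N M : ℕ} (Sigma : Matrix (Fin N) (Fin N) ℝ)
    (l : Fin M → ℝ) (U : Matrix (Fin N) (Fin N) ℝ) : Prop where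
  le : M ≤ N
  antitone : Antitone l
  one_le : ∀ k, 1 ≤ l k
  orthogonal : U ∈ Matrix.orthogonalGroup (Fin N) ℝ
  eq : Sigma = U * Matrix.diagonal (spikedSpectrum N l) * Uᵀ

/-- `X = U diag(√l₁, …, √l_M, 1, …, 1) Z`, where the entries of the random matrix `Z` are
independent and identically distributed, centred, of variance one, and subgaussian with
`ψ₂`-norm at most `K`. -/
structure IsSpikedSample {Ω : Type*} [MeasurableSpace Ω] (P : Measure Ω) (K : ℝ)
    {N M n : ℕ} (l : Fin M → ℝ) (U : Matrix (Fin N) (Fin N) ℝ)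
    (Z X : Ω → Matrix (Fin N) (Fin n) ℝ) : Prop where
  eq : ∀ ω, X ω = U * Matrix.diagonal (fun i => Real.sqrt (spikedSpectrum N l i)) * Z ω
  measurable : ∀ i j, Measurable fun ω => Z ω i j
  indep : iIndepFun (fun (ij : Fin N × Fin n) ω => Z ω ij.1 ij.2) P
  identDistrib : ∀ i j i' j', IdentDistrib (fun ω => Z ω i j) (fun ω => Z ω i' j') P P
  mean : ∀ i j, ∫ ω, Z ω i j ∂P = 0
  variance : ∀ i j, ∫ ω, Z ω i j ^ 2 ∂P = 1
  psiTwo : ∀ i j, psiTwoNorm P (fun ω => Z ω i j) ≤ ENNReal.ofReal K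

/-- The sample covariance matrix `(1/n) X Xᵀ` of the `n` columns of `X`. -/
noncomputable def sampleCovariance {N n : ℕ} (X : Matrix (Fin N) (Fin n) ℝ) :
    Matrix (Fin N) (Fin N) ℝ :=
  (1 / (n : ℝ)) • (X * Xᵀ)

theorem sampleCovariance_isHermitian {N n : ℕ} (X : Matrix (Fin N) (Fin n) ℝ) :
    (sampleCovariance X).IsHermitian := by
  ext i j
  simp [sampleCovariance, Matrix.mul_apply, mul_comm]

/-- The eigenvalues of the sample covariance matrix in non-increasing order, with multiplicity:
the index `k` (counted from `0`) gives the `(k+1)`-st largest one. -/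
noncomputable def sampleEigenvalue {N n : ℕ} (X : Matrix (Fin N) (Fin n) ℝ) (k : Fin N) : ℝ :=
  (sampleCovariance_isHermitian X).eigenvalues₀ (Fin.cast (Fintype.card_fin N).symm k)

/-- `p₁, …, p_M` are linearly independent unit eigenvectors of the sample covariance matrix,
`p_k` belonging to its `k`-th largest eigenvalue. -/
structure IsLeadingEigenvectors {N M n : ℕ} (h : M ≤ N) (X : Matrix (Fin N) (Fin n) ℝ)
    (p : Fin M → EuclideanSpace ℝ (Fin N)) : Prop where
  linearIndependent : LinearIndependent ℝ p
  norm_eq_one : ∀ k, ‖p k‖ = 1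
  eigen : ∀ k, Matrix.toEuclideanLin (sampleCovariance X) (p k) =
    sampleEigenvalue X (Fin.castLE h k) • p k

/-- The column of `U` with index `k`. -/
noncomputable def columnVector {N : ℕ} (U : Matrix (Fin N) (Fin N) ℝ) (k : Fin N) :
    EuclideanSpace ℝ (Fin N) :=
  WithLp.toLp 2 fun i => U i k

/-- The spike that follows `l k`, with value `1` after the last one. -/
noncomputable def nextSpike {M : ℕ} (l : Fin M → ℝ) (k : Fin M) : ℝ≥0∞ :=
  if h : (k : ℕ) + 1 < M then ENNReal.ofReal (l ⟨k + 1, h⟩) else 1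

/-- The spike that precedes `l k`, with value `∞` before the first one. -/
noncomputable def prevSpike {M : ℕ} (l : Fin M → ℝ) (k : Fin M) : ℝ≥0∞ :=
  if (k : ℕ) = 0 then ∞ else ENNReal.ofReal (l ⟨k - 1, by omega⟩)

/-! Put `T = n^{-1/2} Zᵀ`, let `d` be the spectrum of the population covariance and let `y =
diag(√d) Uᵀ p` be the rescaled sample eigenvector. The eigenvector equation becomes `⟨T y, T z⟩ =
lam * ∑ y i * z i / d i` for all `z`, and the weights `y i ^ 2 / d i` are the squared coordinates of
`p` in the population eigenbasis, so they sum to one.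

Two properties of `T` suffice. On the `M` spiked coordinates it is nearly an isometry: a net
argument costs `25 ^ M`, which Bernstein's exponential bound beats because `M / n → 0`. On all `N`
coordinates it is merely bounded, as `N / n ≤ γ`. Min-max then gives `lam ≈ l k` for a large spike
(`sampleEigenvalue_bounds`). Testing the equation on the noise part shows that this part is small,
since `lam` is large. Testing on the spiked part shows that `(1 - lam / d i) * y i` is small in
`ℓ²`; the gaps keep `1 - lam / d i` away from zero for `i ≠ k`, so the weight sits at `k`
(`sum_sq_div_le_of_inner_map_eq`).

The exceptional events involve `Z` only and have summable probabilities. Borel–Cantelli therefore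
needs no joint law, and the choice of eigenvectors is irrelevant. -/

/-! ### Moment generating functions of subgaussian variables and of their squares -/

theorem Real.exp_le_one_add_self_add_sq_mul_exp_abs (x : ℝ) :
    Real.exp x ≤ 1 + x + x ^ 2 * Real.exp |x| := by
  have h := Complex.norm_exp_sub_sum_le_norm_mul_exp (x : ℂ) 2
  have h2 : Complex.exp x - ∑ m ∈ Finset.range 2, (x : ℂ) ^ m / m.factorial
      = ((Real.exp x - (1 + x) : ℝ) : ℂ) := by
    simp [Finset.sum_range_succ]
  rw [h2, Complex.norm_real, Complex.norm_real, Real.norm_eq_abs, Real.norm_eq_abs, sq_abs] at h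
  linarith [le_abs_self (Real.exp x - (1 + x))]

theorem integrable_and_integral_le_of_lintegral_ofReal_le {Ω : Type*} [MeasurableSpace Ω]
    {P : Measure Ω} {f : Ω → ℝ} (hf : Measurable f) (h0 : ∀ ω, 0 ≤ f ω) {b : ℝ} (hb : 0 ≤ b)
    (h : ∫⁻ ω, ENNReal.ofReal (f ω) ∂P ≤ ENNReal.ofReal b) :
    Integrable f P ∧ ∫ ω, f ω ∂P ≤ b := by
  refine ⟨⟨hf.aestronglyMeasurable, ?_⟩, ?_⟩
  · rw [hasFiniteIntegral_iff_ofReal (Eventually.of_forall h0)]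
    exact h.trans_lt ENNReal.ofReal_lt_top
  · rw [integral_eq_lintegral_of_nonneg_ae (Eventually.of_forall h0) hf.aestronglyMeasurable]
    exact ENNReal.toReal_le_of_le_ofReal hb h

theorem hasSubgaussianMGF_of_integral_exp_sq_le {Ω : Type*} [MeasurableSpace Ω] {P : Measure Ω}
    [IsProbabilityMeasure P] {Y : Ω → ℝ} (hY : Measurable Y) (hmean : ∫ ω, Y ω ∂P = 0)
    {t : ℝ} (ht : 0 < t) (hint : Integrable (fun ω => Real.exp (Y ω ^ 2 / t ^ 2)) P)
    (hle : ∫ ω, Real.exp (Y ω ^ 2 / t ^ 2) ∂P ≤ 2) {c : NNReal} (hc : 9 * t ^ 2 ≤ c) :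
    HasSubgaussianMGF Y c P := by
  have hYi : Integrable Y P := by
    refine (hint.const_mul t).mono' hY.aestronglyMeasurable (Eventually.of_forall fun ω => ?_)
    have h1 := Real.add_one_le_exp (Y ω ^ 2 / t ^ 2)
    have h2 : |Y ω| / t ≤ Y ω ^ 2 / t ^ 2 + 1 := by
      rw [← sq_abs (Y ω), ← div_pow]
      nlinarith [sq_nonneg (|Y ω| / t - 1), div_nonneg (abs_nonneg (Y ω)) ht.le]
    rw [Real.norm_eq_abs]
    have h3 := h2.trans h1
    rwa [div_le_iff₀' ht] at h3
  -- The linear term is kept exact so that centring removes it after integration; what remains is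
  -- quadratic in `s`.
  have key : ∀ (s : ℝ) ω, Real.exp (s * Y ω) ≤ 1 + s * Y ω +
      2 * (s ^ 2 * t ^ 2) * Real.exp (s ^ 2 * t ^ 2 / 2) * Real.exp (Y ω ^ 2 / t ^ 2) := by
    intro s ω
    refine (Real.exp_le_one_add_self_add_sq_mul_exp_abs (s * Y ω)).trans (add_le_add le_rfl ?_)
    set b := Y ω ^ 2 / t ^ 2 with hb
    have hYb : Y ω ^ 2 = t ^ 2 * b := by rw [hb]; field_simp
    have h1 : |s * Y ω| ≤ s ^ 2 * t ^ 2 / 2 + b / 2 := by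
      apply abs_le_of_sq_le_sq
      · rw [mul_pow, hYb]
        nlinarith [sq_nonneg (s ^ 2 * t ^ 2 / 2 - b / 2)]
      · positivity
    have h2 : b / 2 ≤ Real.exp (b / 2) := by linarith [Real.add_one_le_exp (b / 2)]
    calc (s * Y ω) ^ 2 * Real.exp |s * Y ω|
        = 2 * (s ^ 2 * t ^ 2) * ((b / 2) * Real.exp |s * Y ω|) := by
          rw [mul_pow, hYb]; ring
      _ ≤ 2 * (s ^ 2 * t ^ 2) * (Real.exp (b / 2) * Real.exp (s ^ 2 * t ^ 2 / 2 + b / 2)) := by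
          gcongr
      _ = _ := by
          rw [← Real.exp_add, mul_assoc (2 * (s ^ 2 * t ^ 2)), ← Real.exp_add]
          ring_nf
  have hdom : ∀ s : ℝ, Integrable (fun ω => 1 + s * Y ω +
      2 * (s ^ 2 * t ^ 2) * Real.exp (s ^ 2 * t ^ 2 / 2) * Real.exp (Y ω ^ 2 / t ^ 2)) P :=
    fun s => ((integrable_const _).add (hYi.const_mul s)).add (hint.const_mul _)
  have hexp : ∀ s : ℝ, Integrable (fun ω => Real.exp (s * Y ω)) P := fun s =>
    (hdom s).mono' (by fun_prop) (Eventually.of_forall fun ω => by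
      rw [Real.norm_eq_abs, abs_of_pos (Real.exp_pos _)]; exact key s ω)
  refine ⟨hexp, fun s => ?_⟩
  calc mgf Y P s ≤ ∫ ω, (1 + s * Y ω +
      2 * (s ^ 2 * t ^ 2) * Real.exp (s ^ 2 * t ^ 2 / 2) * Real.exp (Y ω ^ 2 / t ^ 2)) ∂P :=
        integral_mono (hexp s) (hdom s) (key s)
    _ = 1 + 2 * (s ^ 2 * t ^ 2) * Real.exp (s ^ 2 * t ^ 2 / 2) *
          ∫ ω, Real.exp (Y ω ^ 2 / t ^ 2) ∂P := by
        rw [integral_add (by fun_prop) (by fun_prop), integral_add (by fun_prop) (by fun_prop),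
          integral_const_mul, integral_const_mul, hmean]
        simp
    _ ≤ 1 * Real.exp (s ^ 2 * t ^ 2 / 2)
          + 2 * (s ^ 2 * t ^ 2) * Real.exp (s ^ 2 * t ^ 2 / 2) * 2 := by
        gcongr
        rw [one_mul]
        exact Real.one_le_exp (by positivity)
    _ = Real.exp (s ^ 2 * t ^ 2 / 2) * (4 * (s ^ 2 * t ^ 2) + 1) := by ring
    _ ≤ Real.exp (s ^ 2 * t ^ 2 / 2) * Real.exp (4 * (s ^ 2 * t ^ 2)) := by
        gcongr; exact Real.add_one_le_exp _
    _ ≤ Real.exp (c * s ^ 2 / 2) := by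
        rw [← Real.exp_add]
        gcongr
        nlinarith [sq_nonneg s]

theorem hasSubgaussianMGF_of_psiTwoNorm_le {Ω : Type*} [MeasurableSpace Ω] {P : Measure Ω}
    [IsProbabilityMeasure P] {Y : Ω → ℝ} (hY : Measurable Y) (hmean : ∫ ω, Y ω ∂P = 0)
    {K : ℝ} (hK : 0 < K) (h : psiTwoNorm P Y ≤ ENNReal.ofReal K) {c : NNReal}
    (hc : 36 * K ^ 2 ≤ c) : HasSubgaussianMGF Y c P := by
  -- The infimum need not be known to be attained, so some admissible `t < 2 * K` is used; `9 * (2 *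
  -- K) ^ 2` is the constant `36 * K ^ 2`.
  have h2 : psiTwoNorm P Y < ENNReal.ofReal (2 * K) :=
    h.trans_lt ((ENNReal.ofReal_lt_ofReal_iff (by positivity)).2 (by linarith))
  simp only [psiTwoNorm, iInf_lt_iff] at h2
  obtain ⟨t, ⟨ht, hle⟩, htK⟩ := h2
  rw [ENNReal.ofReal_lt_ofReal_iff (by positivity)] at htK
  obtain ⟨h3, h4⟩ := integrable_and_integral_le_of_lintegral_ofReal_le
    (f := fun ω => Real.exp (Y ω ^ 2 / t ^ 2)) (by fun_prop) (fun ω => (Real.exp_pos _).le)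
    (b := 2) (by norm_num) (by simpa using hle)
  exact hasSubgaussianMGF_of_integral_exp_sq_le hY hmean ht h3 h4 (by nlinarith)

theorem lintegral_exp_sq_gaussianReal :
    ∫⁻ x, ENNReal.ofReal (Real.exp (3 / 8 * x ^ 2)) ∂(gaussianReal 0 1) = 2 := by
  rw [gaussianReal_of_var_ne_zero _ one_ne_zero,
    lintegral_withDensity_eq_lintegral_mul _ (measurable_gaussianPDF 0 1) (by fun_prop)]
  have h : ∀ x : ℝ, (gaussianPDF 0 1 * fun x => ENNReal.ofReal (Real.exp (3 / 8 * x ^ 2))) x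
      = ENNReal.ofReal ((√(2 * Real.pi))⁻¹ * Real.exp (-(1 / 8) * x ^ 2)) := by
    intro x
    rw [Pi.mul_apply, gaussianPDF, ← ENNReal.ofReal_mul (gaussianPDFReal_nonneg _ _ _),
      gaussianPDFReal, mul_assoc, ← Real.exp_add]
    simp only [NNReal.coe_one, mul_one]
    congr 3
    ring
  simp_rw [h]
  rw [← ofReal_integral_eq_lintegral_ofReal
    ((integrable_exp_neg_mul_sq (by norm_num)).const_mul _)
    (Eventually.of_forall fun x => by positivity), integral_const_mul, integral_gaussian,
    show Real.pi / (1 / 8) = 2 ^ 2 * (2 * Real.pi) by ring,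
    Real.sqrt_mul (by norm_num : (0 : ℝ) ≤ 2 ^ 2), Real.sqrt_sq (by norm_num)]
  have : √(2 * Real.pi) ≠ 0 := by positivity
  field_simp
  simp

/-- Gaussian linearization: `exp (a² Y² / 2)` is the average of `exp (a Y x)` over a standard
Gaussian `x`. After swapping integrals, the subgaussian bound in `Y` leaves a Gaussian integral; `a²
= 3 / (4 c)` makes it exactly `2`. -/
theorem ProbabilityTheory.HasSubgaussianMGF.integrable_exp_sq_and_integral_le
    {Ω : Type*} [MeasurableSpace Ω] {P : Measure Ω} [IsProbabilityMeasure P] {Y : Ω → ℝ}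
    (hY : Measurable Y) {c : NNReal} (hc : 0 < c) (h : HasSubgaussianMGF Y c P) :
    Integrable (fun ω => Real.exp (3 / (8 * c) * Y ω ^ 2)) P ∧
      ∫ ω, Real.exp (3 / (8 * c) * Y ω ^ 2) ∂P ≤ 2 := by
  have hc' : (0 : ℝ) < c := hc
  refine integrable_and_integral_le_of_lintegral_ofReal_le (by fun_prop)
    (fun ω => (Real.exp_pos _).le) (by norm_num) ?_
  set a := √(3 / (4 * (c : ℝ))) with ha
  have ha2 : a ^ 2 = 3 / (4 * (c : ℝ)) := Real.sq_sqrt (by positivity)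
  have h1 : ∀ ω, ENNReal.ofReal (Real.exp (3 / (8 * c) * Y ω ^ 2)) =
      ∫⁻ x, ENNReal.ofReal (Real.exp (a * Y ω * x)) ∂(gaussianReal 0 1) := by
    intro ω
    rw [← ofReal_integral_eq_lintegral_ofReal (integrable_exp_mul_gaussianReal _)
      (Eventually.of_forall fun x => (Real.exp_pos _).le)]
    have := congrFun (mgf_fun_id_gaussianReal (μ := 0) (v := 1)) (a * Y ω)
    simp only [mgf] at this
    rw [this]
    congr 2
    rw [mul_pow, ha2]; simp; ring
  simp_rw [h1]
  rw [lintegral_lintegral_swap (by fun_prop)]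
  calc ∫⁻ x, ∫⁻ ω, ENNReal.ofReal (Real.exp (a * Y ω * x)) ∂P ∂(gaussianReal 0 1)
      ≤ ∫⁻ x, ENNReal.ofReal (Real.exp (3 / 8 * x ^ 2)) ∂(gaussianReal 0 1) := by
        refine lintegral_mono fun x => ?_
        have e : ∀ ω, a * Y ω * x = (a * x) * Y ω := fun ω => by ring
        simp_rw [e]
        rw [← ofReal_integral_eq_lintegral_ofReal (h.integrable_exp_mul _)
          (Eventually.of_forall fun x => (Real.exp_pos _).le)]
        refine ENNReal.ofReal_le_ofReal ((h.mgf_le _).trans (le_of_eq ?_))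
        congr 1
        rw [mul_pow, ha2]; field_simp; ring
    _ = ENNReal.ofReal 2 := by rw [lintegral_exp_sq_gaussianReal]; simp

/-- The constant in the quadratic bound for the log-moment generating function of the centred
square of a subgaussian variable. -/
noncomputable def sqMGFConst (θ : ℝ) : ℝ := 16 * Real.exp θ / θ ^ 2

theorem integrable_exp_mul_sq_sub_one_and_mgf_le {Ω : Type*} [MeasurableSpace Ω] {P : Measure Ω}
    [IsProbabilityMeasure P] {Y : Ω → ℝ} (hY : Measurable Y) {θ : ℝ} (hθ : 0 < θ)
    (hint : Integrable (fun ω => Real.exp (θ * Y ω ^ 2)) P)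
    (hle : ∫ ω, Real.exp (θ * Y ω ^ 2) ∂P ≤ 2) (hvar : ∫ ω, Y ω ^ 2 ∂P = 1)
    {s : ℝ} (hs : |s| ≤ θ / 2) :
    Integrable (fun ω => Real.exp (s * (Y ω ^ 2 - 1))) P ∧
      mgf (fun ω => Y ω ^ 2 - 1) P s ≤ Real.exp (sqMGFConst θ * s ^ 2) := by
  have hY2 : Integrable (fun ω => Y ω ^ 2) P := by
    by_contra hn
    rw [integral_undef hn] at hvar
    norm_num at hvar
  have key : ∀ ω, Real.exp (s * (Y ω ^ 2 - 1)) ≤ 1 + s * (Y ω ^ 2 - 1) +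
      s ^ 2 * (8 / θ ^ 2 * Real.exp θ) * Real.exp (θ * Y ω ^ 2) := by
    intro ω
    refine (Real.exp_le_one_add_self_add_sq_mul_exp_abs _).trans (add_le_add le_rfl ?_)
    -- `v` dominates the exponent, and its square controls the quadratic factor up to `4 / θ ^ 2`;
    -- then `v ^ 2 ≤ 2 * exp v` makes the whole remainder a multiple of `exp (2 * v)`, which is
    -- integrable.
    set v := θ / 2 * (Y ω ^ 2 + 1) with hv
    have hv0 : 0 ≤ v := by positivity
    have h1 : |s * (Y ω ^ 2 - 1)| ≤ v := by
      rw [abs_mul]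
      refine mul_le_mul hs ?_ (abs_nonneg _) (by positivity)
      rw [abs_le]; constructor <;> nlinarith [sq_nonneg (Y ω)]
    have h2 : v ^ 2 ≤ 2 * Real.exp v := by linarith [Real.quadratic_le_exp_of_nonneg hv0]
    have h3 : (Y ω ^ 2 - 1) ^ 2 ≤ 4 / θ ^ 2 * v ^ 2 := by
      have : 4 / θ ^ 2 * v ^ 2 = (Y ω ^ 2 + 1) ^ 2 := by rw [hv]; field_simp; norm_num
      rw [this]; nlinarith [sq_nonneg (Y ω)]
    calc (s * (Y ω ^ 2 - 1)) ^ 2 * Real.exp |s * (Y ω ^ 2 - 1)|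
        = s ^ 2 * ((Y ω ^ 2 - 1) ^ 2 * Real.exp |s * (Y ω ^ 2 - 1)|) := by ring
      _ ≤ s ^ 2 * ((4 / θ ^ 2 * (2 * Real.exp v)) * Real.exp v) := by
          gcongr
          exact h3.trans (by gcongr)
      _ = s ^ 2 * (8 / θ ^ 2) * (Real.exp v * Real.exp v) := by ring
      _ = _ := by
          have e : Real.exp v * Real.exp v = Real.exp θ * Real.exp (θ * Y ω ^ 2) := by
            rw [← Real.exp_add, ← Real.exp_add, hv]; ring_nf
          rw [e]; ring
  have hdom : Integrable (fun ω => 1 + s * (Y ω ^ 2 - 1) +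
      s ^ 2 * (8 / θ ^ 2 * Real.exp θ) * Real.exp (θ * Y ω ^ 2)) P :=
    ((integrable_const _).add ((hY2.sub (integrable_const _)).const_mul s)).add (hint.const_mul _)
  have hexp : Integrable (fun ω => Real.exp (s * (Y ω ^ 2 - 1))) P :=
    hdom.mono' (by fun_prop) (Eventually.of_forall fun ω => by
      rw [Real.norm_eq_abs, abs_of_pos (Real.exp_pos _)]; exact key ω)
  refine ⟨hexp, ?_⟩
  calc mgf (fun ω => Y ω ^ 2 - 1) P s ≤ ∫ ω, (1 + s * (Y ω ^ 2 - 1) +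
      s ^ 2 * (8 / θ ^ 2 * Real.exp θ) * Real.exp (θ * Y ω ^ 2)) ∂P := integral_mono hexp hdom key
    _ = 1 + s ^ 2 * (8 / θ ^ 2 * Real.exp θ) * ∫ ω, Real.exp (θ * Y ω ^ 2) ∂P := by
        rw [integral_add (by fun_prop) (by fun_prop), integral_add (by fun_prop) (by fun_prop),
          integral_const_mul, integral_const_mul, integral_sub hY2 (by fun_prop), hvar]
        simp
    _ ≤ 1 + s ^ 2 * (8 / θ ^ 2 * Real.exp θ) * 2 := by gcongr
    _ = sqMGFConst θ * s ^ 2 + 1 := by rw [sqMGFConst]; ring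
    _ ≤ _ := Real.add_one_le_exp _

/-! ### Chernoff bounds for sums of squares -/

section Concentration

variable {Ω : Type*} [MeasurableSpace Ω] {P : Measure Ω} [IsProbabilityMeasure P]

/-- The exponential rate in Bernstein's inequality for centred squares of subgaussian variables. -/
noncomputable def bernsteinRate (θ δ : ℝ) : ℝ := min (θ / 2) (δ / (2 * sqMGFConst θ)) * δ / 2

theorem sqMGFConst_pos {θ : ℝ} (hθ : 0 < θ) : 0 < sqMGFConst θ := by
  unfold sqMGFConst; positivity

theorem bernsteinRate_pos {θ δ : ℝ} (hθ : 0 < θ) (hδ : 0 < δ) : 0 < bernsteinRate θ δ := by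
  have := sqMGFConst_pos hθ
  unfold bernsteinRate
  have : 0 < min (θ / 2) (δ / (2 * sqMGFConst θ)) := lt_min (by positivity) (by positivity)
  positivity

theorem measureReal_abs_sum_sq_sub_one_ge_le {n : ℕ} {Y : Fin n → Ω → ℝ}
    (hY : ∀ j, Measurable (Y j)) (hind : iIndepFun Y P) {θ : ℝ} (hθ : 0 < θ)
    (hint : ∀ j, Integrable (fun ω => Real.exp (θ * Y j ω ^ 2)) P)
    (hle : ∀ j, ∫ ω, Real.exp (θ * Y j ω ^ 2) ∂P ≤ 2) (hvar : ∀ j, ∫ ω, Y j ω ^ 2 ∂P = 1)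
    {δ : ℝ} (hδ : 0 < δ) :
    P.real {ω | δ * n ≤ |∑ j, (Y j ω ^ 2 - 1)|} ≤ 2 * Real.exp (-(bernsteinRate θ δ * n)) := by
  have hA := sqMGFConst_pos hθ
  set A := sqMGFConst θ with hA_def
  -- The minimizer of `A * s ^ 2 - δ * s`, truncated to the range where the quadratic bound on the
  -- log-mgf holds.
  set s := min (θ / 2) (δ / (2 * A)) with hs
  have hs0 : 0 < s := lt_min (by positivity) (by positivity)
  have hs1 : s ≤ θ / 2 := min_le_left _ _
  have hs2 : A * s ≤ δ / 2 := by
    have := min_le_right (θ / 2) (δ / (2 * A))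
    rw [← hs, le_div_iff₀ (by positivity)] at this
    linarith
  have hrate : bernsteinRate θ δ = s * δ / 2 := rfl
  set W : Fin n → Ω → ℝ := fun j ω => Y j ω ^ 2 - 1 with hW
  have hWm : ∀ j, Measurable (W j) := fun j => by simp only [hW]; fun_prop
  have hWind : iIndepFun W P :=
    hind.comp (fun _ y => y ^ 2 - 1) (fun _ => by fun_prop)
  have hsingle : ∀ r : ℝ, |r| ≤ θ / 2 → ∀ j,
      Integrable (fun ω => Real.exp (r * W j ω)) P ∧ mgf (W j) P r ≤ Real.exp (A * r ^ 2) :=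
    fun r hr j => integrable_exp_mul_sq_sub_one_and_mgf_le (hY j) hθ (hint j) (hle j) (hvar j) hr
  have hsum : ∀ r : ℝ, |r| ≤ θ / 2 →
      Integrable (fun ω => Real.exp (r * (∑ j, W j) ω)) P ∧
      mgf (∑ j, W j) P r ≤ Real.exp (A * r ^ 2 * n) := by
    intro r hr
    refine ⟨hWind.integrable_exp_mul_sum hWm fun j _ => (hsingle r hr j).1, ?_⟩
    rw [hWind.mgf_sum hWm]
    calc ∏ j, mgf (W j) P r ≤ ∏ _j : Fin n, Real.exp (A * r ^ 2) :=
          Finset.prod_le_prod (fun j _ => mgf_nonneg) fun j _ => (hsingle r hr j).2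
      _ = _ := by rw [Finset.prod_const, Finset.card_fin, ← Real.exp_nat_mul]; ring_nf
  have hfin : -s * (δ * n) + A * s ^ 2 * n ≤ -(s * δ / 2 * n) := by
    have : (0 : ℝ) ≤ s * n := by positivity
    nlinarith
  have h1 : P.real {ω | δ * n ≤ (∑ j, W j) ω} ≤ Real.exp (-(s * δ / 2 * n)) := by
    obtain ⟨hi, hm⟩ := hsum s (by rwa [abs_of_pos hs0])
    refine (measure_ge_le_exp_mul_mgf (δ * n) hs0.le hi).trans ?_
    refine (mul_le_mul_of_nonneg_left hm (Real.exp_pos _).le).trans ?_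
    rw [← Real.exp_add, Real.exp_le_exp]
    exact hfin
  have h2 : P.real {ω | (∑ j, W j) ω ≤ -(δ * n)} ≤ Real.exp (-(s * δ / 2 * n)) := by
    obtain ⟨hi, hm⟩ := hsum (-s) (by rwa [abs_neg, abs_of_pos hs0])
    refine (measure_le_le_exp_mul_mgf (-(δ * n)) (neg_nonpos.2 hs0.le) hi).trans ?_
    refine (mul_le_mul_of_nonneg_left hm (Real.exp_pos _).le).trans ?_
    rw [← Real.exp_add, Real.exp_le_exp]
    refine le_trans (le_of_eq ?_) (hfin)
    ring
  rw [hrate, two_mul]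
  refine le_trans ?_ (add_le_add h1 h2)
  refine le_trans (measureReal_mono ?_) (measureReal_union_le _ _)
  intro ω hω
  simp only [Set.mem_ofPred_eq, Set.mem_union, Finset.sum_apply] at hω ⊢
  rcases le_abs'.1 hω with h | h
  · exact Or.inr h
  · exact Or.inl h

/-- A crude upper tail whose rate grows linearly in `t`, so that it can beat any entropy factor
exponential in `n`. -/
theorem measureReal_sum_sq_ge_le {n : ℕ} {Y : Fin n → Ω → ℝ}
    (hY : ∀ j, Measurable (Y j)) (hind : iIndepFun Y P) {θ : ℝ} (hθ : 0 < θ)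
    (hint : ∀ j, Integrable (fun ω => Real.exp (θ * Y j ω ^ 2)) P)
    (hle : ∀ j, ∫ ω, Real.exp (θ * Y j ω ^ 2) ∂P ≤ 2) (t : ℝ) :
    P.real {ω | t * n ≤ ∑ j, Y j ω ^ 2} ≤ Real.exp ((Real.log 2 - θ * t) * n) := by
  set W : Fin n → Ω → ℝ := fun j ω => Y j ω ^ 2 with hW
  have hWm : ∀ j, Measurable (W j) := fun j => by simp only [hW]; fun_prop
  have hWind : iIndepFun W P := hind.comp (fun _ y => y ^ 2) (fun _ => by fun_prop)
  have hm : mgf (∑ j, W j) P θ ≤ Real.exp (Real.log 2 * n) := by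
    rw [hWind.mgf_sum hWm]
    calc ∏ j, mgf (W j) P θ ≤ ∏ _j : Fin n, (2 : ℝ) :=
          Finset.prod_le_prod (fun j _ => mgf_nonneg) fun j _ => hle j
      _ = _ := by
          rw [Finset.prod_const, Finset.card_fin, mul_comm, Real.exp_nat_mul,
            Real.exp_log (by norm_num)]
  have h := measure_ge_le_exp_mul_mgf (t * n) hθ.le
    (hWind.integrable_exp_mul_sum hWm (s := Finset.univ) fun j _ => hint j)
  simp only [Finset.sum_apply] at h
  refine h.trans ((mul_le_mul_of_nonneg_left hm (Real.exp_pos _).le).trans ?_)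
  rw [← Real.exp_add, Real.exp_le_exp]
  exact le_of_eq (by ring)

end Concentration

/-! ### Matrices with independent subgaussian entries -/

/-- The joint law is a product over pairs, and currying turns it into a product over `ι` of products
over `κ`. -/
theorem iIndepFun_curry {Ω ι κ : Type*} [MeasurableSpace Ω] {P : Measure Ω}
    {X : ι → κ → Ω → ℝ} (mX : ∀ i j, Measurable (X i j))
    (h : iIndepFun (fun (p : ι × κ) ω => X p.1 p.2 ω) P) :
    iIndepFun (fun i ω => (X i · ω)) P := by
  have := h.isProbabilityMeasure
  have : ∀ i j, IsProbabilityMeasure (P.map (X i j)) :=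
    fun i j => Measure.isProbabilityMeasure_map (mX i j).aemeasurable
  have hrow : ∀ i, P.map (fun ω => (X i · ω)) = Measure.infinitePi fun j => P.map (X i j) :=
    fun i => (h.precomp (Prod.mk_right_injective i)).map_fun_eq_infinitePi_map (mX i)
  have hcomp : (MeasurableEquiv.curry ι κ ℝ) ∘ (fun ω (p : ι × κ) => X p.1 p.2 ω)
      = fun ω i j => X i j ω := by
    ext; rfl
  rw [iIndepFun_iff_map_fun_eq_infinitePi_map (by fun_prop)]
  simp_rw [hrow]
  rw [← Measure.infinitePi_map_curry (fun i j => P.map (X i j)),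
    ← hcomp, ← Measure.map_map (by fun_prop) (by fun_prop),
    iIndepFun.map_fun_eq_infinitePi_map (X := fun (p : ι × κ) ω => X p.1 p.2 ω)
      (fun p => mX p.1 p.2) h]

/-- A random matrix with independent entries of mean square one and subgaussian with parameter
`c`. -/
structure IsSubgaussianMatrix {Ω : Type*} [MeasurableSpace Ω] (P : Measure Ω) (c : NNReal)
    {m n : ℕ} (A : Ω → Matrix (Fin m) (Fin n) ℝ) : Prop where
  measurable : ∀ i j, Measurable fun ω => A ω i j
  indep : iIndepFun (fun (ij : Fin m × Fin n) ω => A ω ij.1 ij.2) P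
  subgaussian : ∀ i j, HasSubgaussianMGF (fun ω => A ω i j) c P
  mean : ∀ i j, ∫ ω, A ω i j ∂P = 0
  variance : ∀ i j, ∫ ω, A ω i j ^ 2 ∂P = 1

namespace IsSubgaussianMatrix

variable {Ω : Type*} [MeasurableSpace Ω] {P : Measure Ω} {c : NNReal}
  {m n : ℕ} {A : Ω → Matrix (Fin m) (Fin n) ℝ}

theorem submatrix (h : IsSubgaussianMatrix P c A) {m' : ℕ} {f : Fin m' → Fin m}
    (hf : Function.Injective f) : IsSubgaussianMatrix P c fun ω => (A ω).submatrix f id where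
  measurable i j := h.measurable (f i) j
  indep := h.indep.precomp (g := Prod.map f id) (hf.prodMap Function.injective_id)
  subgaussian i j := h.subgaussian (f i) j
  mean i j := h.mean (f i) j
  variance i j := h.variance (f i) j

theorem measurable_column (h : IsSubgaussianMatrix P c A) (x : Fin m → ℝ) (j : Fin n) :
    Measurable fun ω => ∑ i, x i * A ω i j :=
  Finset.measurable_sum _ fun i _ => (h.measurable i j).const_mul _

theorem iIndepFun_column (h : IsSubgaussianMatrix P c A) (x : Fin m → ℝ) :
    iIndepFun (fun (j : Fin n) ω => ∑ i, x i * A ω i j) P := by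
  have h1 : iIndepFun (fun (p : Fin n × Fin m) ω => A ω p.2 p.1) P :=
    h.indep.precomp (g := Prod.swap) Prod.swap_injective
  have h2 := iIndepFun_curry (X := fun j i ω => A ω i j) (fun j i => h.measurable i j) h1
  exact h2.comp (fun _ y => ∑ i, x i * y i) (fun _ => by fun_prop)

theorem iIndepFun_smul (h : IsSubgaussianMatrix P c A) (x : Fin m → ℝ) (j : Fin n) :
    iIndepFun (fun (i : Fin m) ω => x i * A ω i j) P :=
  (h.indep.precomp (g := fun i => (i, j)) (Prod.mk_left_injective j)).comp (fun i y => x i * y)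
    (fun _ => by fun_prop)

/-- Subgaussian parameters of independent summands add, and scaling by `x i` multiplies them by `x i
^ 2`; the bound is thus uniform over unit vectors and dimensions. -/
theorem hasSubgaussianMGF_column (h : IsSubgaussianMatrix P c A) {x : Fin m → ℝ}
    (hx : ∑ i, x i ^ 2 = 1) (j : Fin n) :
    HasSubgaussianMGF (fun ω => ∑ i, x i * A ω i j) c P := by
  have hi : ∀ i, HasSubgaussianMGF (fun ω => x i * A ω i j) (Real.toNNReal (x i ^ 2) * c) P := by
    intro i
    rw [Real.toNNReal_of_nonneg (sq_nonneg _)]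
    exact (h.subgaussian i j).const_mul (x i)
  have := HasSubgaussianMGF.sum_of_iIndepFun (h.iIndepFun_smul x j) (s := Finset.univ)
    fun i _ => hi i
  rwa [← Finset.sum_mul, ← Real.toNNReal_sum_of_nonneg fun i _ => sq_nonneg (x i), hx,
    Real.toNNReal_one, one_mul] at this

theorem integral_column_sq [IsProbabilityMeasure P] (h : IsSubgaussianMatrix P c A) {x : Fin m → ℝ}
    (hx : ∑ i, x i ^ 2 = 1) (j : Fin n) :
    ∫ ω, (∑ i, x i * A ω i j) ^ 2 ∂P = 1 := by
  have hL : ∀ i, MemLp (fun ω => x i * A ω i j) 2 P := fun i =>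
    ((h.subgaussian i j).memLp 2).const_mul (x i)
  have hmean : ∀ i, ∫ ω, x i * A ω i j ∂P = 0 := fun i => by
    rw [integral_const_mul, h.mean, mul_zero]
  have hv := IndepFun.variance_sum (s := Finset.univ) (fun i _ => hL i)
    (fun i _ k _ hik => (h.iIndepFun_smul x j).indepFun hik)
  have hsum : (∑ i, fun ω => x i * A ω i j) = fun ω => ∑ i, x i * A ω i j := by
    ext; simp
  rw [hsum, variance_of_integral_eq_zero (h.measurable_column x j).aemeasurable] at hv
  · rw [hv, ← hx]
    refine Finset.sum_congr rfl fun i _ => ?_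
    rw [variance_of_integral_eq_zero ((h.measurable i j).const_mul _).aemeasurable (hmean i)]
    simp_rw [mul_pow]
    rw [integral_const_mul, h.variance, mul_one]
  · rw [integral_finsetSum _ fun i _ => (hL i).integrable (by norm_num)]
    exact Finset.sum_eq_zero fun i _ => hmean i

end IsSubgaussianMatrix

/-! ### Nets on the unit sphere -/

/-- A largest `1/2`-separated subset of the sphere works: a point far from all its members could be
added to it. -/
theorem exists_half_net (E : Type*) [NormedAddCommGroup E] [NormedSpace ℝ E]
    [FiniteDimensional ℝ E] :
    ∃ S : Finset E, S.card ≤ 5 ^ Module.finrank ℝ E ∧ (∀ s ∈ S, ‖s‖ = 1) ∧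
      ∀ x : E, ‖x‖ = 1 → ∃ s ∈ S, ‖x - s‖ ≤ 1 / 2 := by
  classical
  let sep : Finset E → Prop := fun S =>
    (∀ s ∈ S, ‖s‖ = 1) ∧ ∀ s ∈ S, ∀ t ∈ S, s ≠ t → 1 / 2 < ‖s - t‖
  have hcard : ∀ S, sep S → S.card ≤ 5 ^ Module.finrank ℝ E := by
    intro S hS
    -- Doubling gives points of norm `2` at mutual distance at least `1`, the normalization of
    -- `Besicovitch.card_le_of_separated`.
    have hinj : Function.Injective fun x : E => (2 : ℝ) • x :=
      smul_right_injective E (by norm_num)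
    rw [← Finset.card_image_of_injective S hinj]
    apply Besicovitch.card_le_of_separated
    · intro c hc
      obtain ⟨s, hs, rfl⟩ := Finset.mem_image.1 hc
      rw [norm_smul, hS.1 s hs]; norm_num
    · intro c hc d hd hcd
      obtain ⟨s, hs, rfl⟩ := Finset.mem_image.1 hc
      obtain ⟨t, ht, rfl⟩ := Finset.mem_image.1 hd
      have := hS.2 s hs t ht (fun h => hcd (by rw [h]))
      rw [← smul_sub, norm_smul]; norm_num; linarith
  let p : ℕ → Prop := fun k => ∃ S, sep S ∧ S.card = k
  have h0 : p 0 := ⟨∅, by simp [sep], by simp⟩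
  obtain ⟨S, hS, hSc⟩ := Nat.findGreatest_spec (P := p) (Nat.zero_le (5 ^ Module.finrank ℝ E)) h0
  refine ⟨S, hcard S hS, hS.1, fun x hx => ?_⟩
  by_contra! hfar
  have hxS : x ∉ S := fun h => by
    have := hfar x h
    simp at this; linarith
  have hins : sep (insert x S) := by
    refine ⟨fun s hs => ?_, fun s hs t ht hst => ?_⟩
    · rcases Finset.mem_insert.1 hs with rfl | hs
      exacts [hx, hS.1 s hs]
    · rcases Finset.mem_insert.1 hs with rfl | hs'
      · exact hfar t (Finset.mem_of_mem_insert_of_ne ht hst.symm)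
      · rcases Finset.mem_insert.1 ht with rfl | ht'
        · rw [norm_sub_rev]; exact hfar s hs'
        · exact hS.2 s hs' t ht' hst
  have := Nat.le_findGreatest (P := p) (hcard _ hins) ⟨_, hins, rfl⟩
  rw [Finset.card_insert_of_notMem hxS] at this
  omega

theorem ContinuousLinearMap.opNorm_le_two_mul_of_half_net {E F : Type*} [NormedAddCommGroup E]
    [NormedSpace ℝ E] [NormedAddCommGroup F] [NormedSpace ℝ F] {S : Finset E}
    (hS : ∀ x : E, ‖x‖ = 1 → ∃ s ∈ S, ‖x - s‖ ≤ 1 / 2) (f : E →L[ℝ] F) {a : ℝ} (ha : 0 ≤ a)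
    (hf : ∀ s ∈ S, ‖f s‖ ≤ a) : ‖f‖ ≤ 2 * a := by
  have h : ‖f‖ ≤ a + ‖f‖ / 2 := by
    refine ContinuousLinearMap.opNorm_le_of_unit_norm (by positivity) fun x hx => ?_
    obtain ⟨s, hs, hxs⟩ := hS x hx
    calc ‖f x‖ = ‖f s + f (x - s)‖ := by rw [map_sub, add_sub_cancel]
      _ ≤ ‖f s‖ + ‖f (x - s)‖ := norm_add_le _ _
      _ ≤ a + ‖f‖ * ‖x - s‖ := add_le_add (hf s hs) (f.le_opNorm _)
      _ ≤ a + ‖f‖ / 2 := by nlinarith [norm_nonneg f]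
  linarith

/-- If `T` almost preserves the norms of the sums and differences of points of a net, then it
almost preserves inner products. -/
theorem abs_inner_map_sub_inner_le_of_half_net {E F : Type*} [NormedAddCommGroup E]
    [InnerProductSpace ℝ E] [NormedAddCommGroup F] [InnerProductSpace ℝ F] {S : Finset E}
    (hS1 : ∀ s ∈ S, ‖s‖ = 1) (hS : ∀ x : E, ‖x‖ = 1 → ∃ s ∈ S, ‖x - s‖ ≤ 1 / 2)
    (T : E →L[ℝ] F) {δ : ℝ} (hδ : 0 ≤ δ)
    (hadd : ∀ s ∈ S, ∀ t ∈ S, |‖T (s + t)‖ ^ 2 - ‖s + t‖ ^ 2| ≤ δ * ‖s + t‖ ^ 2)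
    (hsub : ∀ s ∈ S, ∀ t ∈ S, |‖T (s - t)‖ ^ 2 - ‖s - t‖ ^ 2| ≤ δ * ‖s - t‖ ^ 2) (x y : E) :
    |inner ℝ (T x) (T y) - inner ℝ x y| ≤ 4 * δ * ‖x‖ * ‖y‖ := by
  let b : E →L[ℝ] E →L[ℝ] ℝ := (innerSL ℝ).bilinearComp T T - innerSL ℝ
  have hb : ∀ x y, b x y = inner ℝ (T x) (T y) - inner ℝ x y := fun x y => by
    simp only [b, sub_apply, ContinuousLinearMap.bilinearComp_apply]
    rfl
  -- Polarization: the two errors add up to `δ * (‖s + t‖ ^ 2 + ‖s - t‖ ^ 2) = 4 * δ`, to be divided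
  -- by `4`.
  have h1 : ∀ s ∈ S, ∀ t ∈ S, ‖b s t‖ ≤ δ := by
    intro s hs t ht
    have e1 := abs_le.1 (hadd s hs t ht)
    have e2 := abs_le.1 (hsub s hs t ht)
    rw [hb, Real.norm_eq_abs, abs_le]
    rw [map_add, norm_add_sq_real, norm_add_sq_real, hS1 s hs, hS1 t ht] at e1
    rw [map_sub, norm_sub_sq_real, norm_sub_sq_real, hS1 s hs, hS1 t ht] at e2
    constructor <;> nlinarith [e1.1, e1.2, e2.1, e2.2]
  have h2 : ‖b‖ ≤ 2 * (2 * δ) :=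
    b.opNorm_le_two_mul_of_half_net hS (by positivity) fun s hs =>
      (b s).opNorm_le_two_mul_of_half_net hS hδ (h1 s hs)
  rw [← hb, ← Real.norm_eq_abs]
  calc ‖b x y‖ ≤ ‖b‖ * ‖x‖ * ‖y‖ := b.le_opNorm₂ x y
    _ ≤ 4 * δ * ‖x‖ * ‖y‖ := by gcongr; linarith

/-! ### Uniform bounds for the Gram operator of a random matrix -/

/-- The map `x ↦ n^{-1/2} Aᵀ x`. -/
noncomputable def gramMap {m n : ℕ} (A : Matrix (Fin m) (Fin n) ℝ) :
    EuclideanSpace ℝ (Fin m) →L[ℝ] EuclideanSpace ℝ (Fin n) :=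
  LinearMap.toContinuousLinearMap ((√(n : ℝ))⁻¹ • Matrix.toEuclideanLin Aᵀ)

theorem gramMap_apply {m n : ℕ} (A : Matrix (Fin m) (Fin n) ℝ) (x : EuclideanSpace ℝ (Fin m))
    (j : Fin n) : gramMap A x j = (√(n : ℝ))⁻¹ * ∑ i, x i * A i j := by
  simp [gramMap, Matrix.mulVec, dotProduct, mul_comm]

theorem inner_gramMap {m n : ℕ} (A : Matrix (Fin m) (Fin n) ℝ) (x y : EuclideanSpace ℝ (Fin m)) :
    inner ℝ (gramMap A x) (gramMap A y)
      = (∑ j, (∑ i, x i * A i j) * (∑ i, y i * A i j)) / n := by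
  rw [PiLp.inner_apply]
  simp only [gramMap_apply, RCLike.inner_apply, conj_trivial]
  rw [Finset.sum_div]
  refine Finset.sum_congr rfl fun j _ => ?_
  have : (√(n : ℝ))⁻¹ * (√(n : ℝ))⁻¹ = (n : ℝ)⁻¹ := by
    rw [← mul_inv, Real.mul_self_sqrt (Nat.cast_nonneg n)]
  rw [div_eq_mul_inv, ← this]; ring

theorem norm_gramMap_sq {m n : ℕ} (A : Matrix (Fin m) (Fin n) ℝ) (x : EuclideanSpace ℝ (Fin m)) :
    ‖gramMap A x‖ ^ 2 = (∑ j, (∑ i, x i * A i j) ^ 2) / n := by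
  rw [← real_inner_self_eq_norm_sq, inner_gramMap]
  simp only [sq]

namespace IsSubgaussianMatrix

variable {Ω : Type*} [MeasurableSpace Ω] {P : Measure Ω} [IsProbabilityMeasure P] {c : NNReal}
  {m n : ℕ} {A : Ω → Matrix (Fin m) (Fin n) ℝ}

theorem measureReal_norm_gramMap_deviation_le (h : IsSubgaussianMatrix P c A) (hc : 0 < c)
    (hn : 0 < n) {δ : ℝ} (hδ : 0 < δ) (v : EuclideanSpace ℝ (Fin m)) :
    P.real {ω | ¬ |‖gramMap (A ω) v‖ ^ 2 - ‖v‖ ^ 2| ≤ δ * ‖v‖ ^ 2} ≤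
      2 * Real.exp (-(bernsteinRate (3 / (8 * c)) δ * n)) := by
  rcases eq_or_ne v 0 with rfl | hv
  · simp; positivity
  have hv' : 0 < ‖v‖ := norm_pos_iff.2 hv
  set u : EuclideanSpace ℝ (Fin m) := ‖v‖⁻¹ • v with hu
  have hu1 : ∑ i, u i ^ 2 = 1 := by
    rw [← EuclideanSpace.real_norm_sq_eq, hu, norm_smul, norm_inv, norm_norm,
      inv_mul_cancel₀ hv'.ne', one_pow]
  have hvu : v = ‖v‖ • u := by rw [hu, smul_smul, mul_inv_cancel₀ hv'.ne', one_smul]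
  have hc' : (0 : ℝ) < c := hc
  have hb : ∀ j, _ := fun j => (h.hasSubgaussianMGF_column hu1 j).integrable_exp_sq_and_integral_le
    (h.measurable_column u j) hc
  refine le_trans (measureReal_mono fun ω hω => ?_)
    (measureReal_abs_sum_sq_sub_one_ge_le (fun j => h.measurable_column u j)
    (h.iIndepFun_column u) (by positivity) (fun j => (hb j).1) (fun j => (hb j).2)
    (h.integral_column_sq hu1) hδ)
  rw [Set.mem_ofPred_eq, hvu, map_smul, norm_smul, norm_norm, mul_pow, norm_gramMap_sq, norm_smul,
    norm_norm, mul_pow, EuclideanSpace.real_norm_sq_eq u, hu1, ← mul_sub, abs_mul,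
    abs_of_nonneg (sq_nonneg ‖v‖), mul_one, not_le, mul_comm,
    mul_lt_mul_iff_of_pos_left (by positivity)] at hω
  have hn' : (0 : ℝ) < n := by exact_mod_cast hn
  rw [Set.mem_ofPred_eq, Finset.sum_sub_distrib]
  rw [← mul_lt_mul_iff_of_pos_right hn'] at hω
  refine hω.le.trans (le_of_eq ?_)
  rw [← abs_of_pos hn', ← abs_mul, abs_of_pos hn', sub_mul, div_mul_cancel₀ _ hn'.ne']
  simp

theorem measureReal_inner_gramMap_deviation_le (h : IsSubgaussianMatrix P c A) (hc : 0 < c)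
    (hn : 0 < n) {δ : ℝ} (hδ : 0 < δ) :
    P.real {ω | ¬ ∀ x y, |inner ℝ (gramMap (A ω) x) (gramMap (A ω) y) - inner ℝ x y|
        ≤ 4 * δ * ‖x‖ * ‖y‖} ≤
      4 * 25 ^ m * Real.exp (-(bernsteinRate (3 / (8 * c)) δ * n)) := by
  obtain ⟨S, hScard, hS1, hS⟩ := exists_half_net (EuclideanSpace ℝ (Fin m))
  rw [finrank_euclideanSpace, Fintype.card_fin] at hScard
  set q := Real.exp (-(bernsteinRate (3 / (8 * c)) δ * n)) with hq
  let bad : EuclideanSpace ℝ (Fin m) → Set Ω := fun v =>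
    {ω | ¬ |‖gramMap (A ω) v‖ ^ 2 - ‖v‖ ^ 2| ≤ δ * ‖v‖ ^ 2}
  have hbad : ∀ v, P.real (bad v) ≤ 2 * q :=
    h.measureReal_norm_gramMap_deviation_le hc hn hδ
  -- At most `(5 ^ m) ^ 2 = 25 ^ m` pairs, each with two vectors failing with probability at most `2
  -- * q`.
  calc _ ≤ P.real (⋃ p ∈ S ×ˢ S, (bad (p.1 + p.2) ∪ bad (p.1 - p.2))) := by
        refine measureReal_mono (fun ω hω => ?_) (measure_ne_top _ _)
        by_contra hcon
        simp only [Set.mem_iUnion, Set.mem_union, Finset.mem_product, not_exists, not_or, bad,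
          Set.mem_ofPred_eq, not_not] at hcon
        exact hω (abs_inner_map_sub_inner_le_of_half_net hS1 hS _ hδ.le
          (fun s hs t ht => (hcon (s, t) ⟨hs, ht⟩).1) (fun s hs t ht => (hcon (s, t) ⟨hs, ht⟩).2))
    _ ≤ ∑ p ∈ S ×ˢ S, P.real (bad (p.1 + p.2) ∪ bad (p.1 - p.2)) :=
        measureReal_biUnion_finset_le _ _
    _ ≤ ∑ p ∈ S ×ˢ S, (2 * q + 2 * q) := Finset.sum_le_sum fun p _ =>
        (measureReal_union_le _ _).trans (add_le_add (hbad _) (hbad _))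
    _ = (S.card : ℝ) * S.card * (4 * q) := by
        rw [Finset.sum_const, Finset.card_product, nsmul_eq_mul]; push_cast; ring
    _ ≤ (5 : ℝ) ^ m * (5 : ℝ) ^ m * (4 * q) := by
        have : (S.card : ℝ) ≤ (5 : ℝ) ^ m := by exact_mod_cast hScard
        gcongr
    _ = _ := by rw [← mul_pow]; norm_num; ring

theorem measureReal_norm_gramMap_large_le (h : IsSubgaussianMatrix P c A) (hc : 0 < c)
    (hn : 0 < n) {t : ℝ} (ht : 0 ≤ t) :
    P.real {ω | ¬ ∀ x, ‖gramMap (A ω) x‖ ^ 2 ≤ 4 * t * ‖x‖ ^ 2} ≤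
      5 ^ m * Real.exp ((Real.log 2 - 3 / (8 * c) * t) * n) := by
  obtain ⟨S, hScard, hS1, hS⟩ := exists_half_net (EuclideanSpace ℝ (Fin m))
  rw [finrank_euclideanSpace, Fintype.card_fin] at hScard
  have hc' : (0 : ℝ) < c := hc
  have hn' : (0 : ℝ) < n := by exact_mod_cast hn
  set q := Real.exp ((Real.log 2 - 3 / (8 * c) * t) * n) with hq
  let bad : EuclideanSpace ℝ (Fin m) → Set Ω := fun v => {ω | t * n ≤ ∑ j, (∑ i, v i * A ω i j) ^ 2}
  have hbad : ∀ v ∈ S, P.real (bad v) ≤ q := fun v hv => by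
    have hv1 : ∑ i, v i ^ 2 = 1 := by
      rw [← EuclideanSpace.real_norm_sq_eq, hS1 v hv, one_pow]
    have hb : ∀ j, _ := fun j =>
      (h.hasSubgaussianMGF_column hv1 j).integrable_exp_sq_and_integral_le
        (h.measurable_column v j) hc
    exact measureReal_sum_sq_ge_le (fun j => h.measurable_column v j)
      (h.iIndepFun_column v) (by positivity) (fun j => (hb j).1) (fun j => (hb j).2) t
  calc _ ≤ P.real (⋃ v ∈ S, bad v) := by
        refine measureReal_mono (fun ω hω => ?_) (measure_ne_top _ _)
        by_contra hcon
        simp only [Set.mem_iUnion, not_exists, bad, Set.mem_ofPred_eq, not_le] at hcon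
        refine hω fun x => ?_
        have hT : ‖gramMap (A ω)‖ ≤ 2 * √t := by
          refine ContinuousLinearMap.opNorm_le_two_mul_of_half_net hS _ (Real.sqrt_nonneg t)
            fun s hs => Real.le_sqrt_of_sq_le ?_
          rw [norm_gramMap_sq, div_le_iff₀ hn']
          exact (hcon s hs).le
        calc ‖gramMap (A ω) x‖ ^ 2 ≤ (2 * √t * ‖x‖) ^ 2 := by
              gcongr; exact (ContinuousLinearMap.le_opNorm _ x).trans (by gcongr)
          _ = 4 * t * ‖x‖ ^ 2 := by rw [mul_pow, mul_pow, Real.sq_sqrt ht]; norm_num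
    _ ≤ ∑ v ∈ S, P.real (bad v) := measureReal_biUnion_finset_le _ _
    _ ≤ ∑ v ∈ S, q := Finset.sum_le_sum hbad
    _ = (S.card : ℝ) * q := by rw [Finset.sum_const, nsmul_eq_mul]
    _ ≤ (5 : ℝ) ^ m * q := by
        have : (S.card : ℝ) ≤ (5 : ℝ) ^ m := by exact_mod_cast hScard
        gcongr

end IsSubgaussianMatrix

/-! ### One-sided min-max bounds -/

section Eigenvalues

variable {N : ℕ} {E : Type*} [NormedAddCommGroup E] [InnerProductSpace ℝ E]

/-- There are only `N - 1` linear conditions, one for each index other than `k`. -/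
theorem exists_ne_zero_inner_eq_zero [FiniteDimensional ℝ E] (u v : OrthonormalBasis (Fin N) ℝ E) (k : Fin N) :
    ∃ x : E, x ≠ 0 ∧ (∀ i, k < i → inner ℝ (u i) x = 0) ∧ ∀ j, j < k → inner ℝ (v j) x = 0 := by
  let f : E →ₗ[ℝ] ({i // i ≠ k} → ℝ) :=
    LinearMap.pi fun i => if k < i.1 then innerₛₗ ℝ (u i) else innerₛₗ ℝ (v i)
  have hE : Module.finrank ℝ E = N := by
    rw [Module.finrank_eq_card_basis u.toBasis, Fintype.card_fin]
  have hf : LinearMap.ker f ≠ ⊥ := by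
    refine LinearMap.ker_ne_bot_of_finrank_lt ?_
    rw [hE, Module.finrank_fintype_fun_eq_card, Fintype.card_subtype_compl, Fintype.card_fin,
      Fintype.card_subtype_eq]
    have := k.pos
    omega
  obtain ⟨x, hx, hx0⟩ := Submodule.exists_mem_ne_zero_of_ne_bot hf
  have h : ∀ i : {i // i ≠ k}, f x i = 0 := fun i => by
    rw [LinearMap.mem_ker.1 hx]; rfl
  refine ⟨x, hx0, fun i hi => ?_, fun j hj => ?_⟩
  · simpa [f, hi] using h ⟨i, hi.ne'⟩
  · simpa [f, hj.not_gt] using h ⟨j, hj.ne⟩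

variable {S : E →ₗ[ℝ] E} {v : OrthonormalBasis (Fin N) ℝ E} {μ : Fin N → ℝ}

theorem inner_apply_self_eq_sum (hv : ∀ j, S (v j) = μ j • v j) (x : E) :
    inner ℝ (S x) x = ∑ j, μ j * inner ℝ (v j) x ^ 2 := by
  conv_lhs => rw [← v.sum_repr' x]
  rw [map_sum, sum_inner]
  refine Finset.sum_congr rfl fun j _ => ?_
  rw [map_smul, hv, v.sum_repr' x, real_inner_smul_left, real_inner_smul_left]
  ring

theorem norm_sq_eq_sum_inner_sq (v : OrthonormalBasis (Fin N) ℝ E) (x : E) :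
    ‖x‖ ^ 2 = ∑ j, inner ℝ (v j) x ^ 2 := by
  rw [← v.sum_sq_norm_inner_right x]
  simp

theorem le_eigenvalue_of_forall_le [FiniteDimensional ℝ E]
    (hv : ∀ j, S (v j) = μ j • v j) (hμ : Antitone μ)
    (u : OrthonormalBasis (Fin N) ℝ E) (k : Fin N) {a : ℝ}
    (h : ∀ x, (∀ i, k < i → inner ℝ (u i) x = 0) → a * ‖x‖ ^ 2 ≤ inner ℝ (S x) x) : a ≤ μ k := by
  obtain ⟨x, hx0, hxu, hxv⟩ := exists_ne_zero_inner_eq_zero u v k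
  have h1 : inner ℝ (S x) x ≤ μ k * ‖x‖ ^ 2 := by
    rw [inner_apply_self_eq_sum hv, norm_sq_eq_sum_inner_sq v, Finset.mul_sum]
    refine Finset.sum_le_sum fun j _ => ?_
    rcases lt_or_ge j k with hj | hj
    · rw [hxv j hj]; simp
    · exact mul_le_mul_of_nonneg_right (hμ hj) (sq_nonneg _)
  exact le_of_mul_le_mul_right ((h x hxu).trans h1) (by positivity)

theorem eigenvalue_le_of_forall_le [FiniteDimensional ℝ E]
    (hv : ∀ j, S (v j) = μ j • v j) (hμ : Antitone μ)
    (u : OrthonormalBasis (Fin N) ℝ E) (k : Fin N) {a : ℝ}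
    (h : ∀ x, (∀ i, i < k → inner ℝ (u i) x = 0) → inner ℝ (S x) x ≤ a * ‖x‖ ^ 2) : μ k ≤ a := by
  obtain ⟨x, hx0, hxv, hxu⟩ := exists_ne_zero_inner_eq_zero v u k
  have h1 : μ k * ‖x‖ ^ 2 ≤ inner ℝ (S x) x := by
    rw [inner_apply_self_eq_sum hv, norm_sq_eq_sum_inner_sq v, Finset.mul_sum]
    refine Finset.sum_le_sum fun j _ => ?_
    rcases lt_or_ge k j with hj | hj
    · rw [hxv j hj]; simp
    · exact mul_le_mul_of_nonneg_right (hμ hj) (sq_nonneg _)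
  exact le_of_mul_le_mul_right (h1.trans (h x hxu)) (by positivity)

end Eigenvalues

/-! ### Deterministic localization of eigenvectors -/

section Eigenvector

variable {ι F : Type*} [DecidableEq ι] [NormedAddCommGroup F] [InnerProductSpace ℝ F]

/-- The restriction of a vector to the coordinates in `s`. -/
noncomputable def coordRestrict (s : Finset ι) (y : EuclideanSpace ℝ ι) :
    EuclideanSpace ℝ ι := WithLp.toLp 2 fun i => if i ∈ s then y i else 0

theorem coordRestrict_apply (s : Finset ι) (y : EuclideanSpace ℝ ι) (i : ι) :
    coordRestrict s y i = if i ∈ s then y i else 0 := rfl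

variable [Fintype ι]

theorem coordRestrict_add_compl (s : Finset ι) (y : EuclideanSpace ℝ ι) :
    coordRestrict s y + coordRestrict sᶜ y = y := by
  ext i
  by_cases h : i ∈ s <;> simp [coordRestrict_apply, h]

theorem norm_coordRestrict_sq (s : Finset ι) (y : EuclideanSpace ℝ ι) :
    ‖coordRestrict s y‖ ^ 2 = ∑ i ∈ s, y i ^ 2 := by
  rw [EuclideanSpace.real_norm_sq_eq]
  simp [coordRestrict_apply, Finset.sum_ite_mem]

/-- Localization of an eigenvector of a spiked Gram operator: `y` is the rescaled eigenvector,
`lam` the eigenvalue, `s` the set of spikes. -/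
theorem sum_sq_div_le_of_inner_map_eq {s : Finset ι} {k : ι} (hk : k ∈ s) {d : ι → ℝ}
    (hd : ∀ i, 0 < d i) (hd1 : ∀ i, i ∉ s → d i = 1) (T : EuclideanSpace ℝ ι →L[ℝ] F)
    {δ C lam g : ℝ} (hδ : 0 ≤ δ) (hC : 0 ≤ C) (hlam : 0 < lam) (hClam : 2 * C ≤ lam) (hg : 0 < g)
    (hT1 : ∀ x y : EuclideanSpace ℝ ι, (∀ i ∉ s, x i = 0) → (∀ i ∉ s, y i = 0) →
      |inner ℝ (T x) (T y) - inner ℝ x y| ≤ δ * ‖x‖ * ‖y‖)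
    (hT2 : ∀ x y, |inner ℝ (T x) (T y)| ≤ C * ‖x‖ * ‖y‖)
    (hgap : ∀ i ∈ s, i ≠ k → g ≤ (1 - lam / d i) ^ 2 ∧ g * (lam / d i) ≤ (1 - lam / d i) ^ 2)
    (hη : (δ + 2 * C ^ 2 / lam) ^ 2 ≤ g / 2) (hdk : d k ≤ 2 * lam)
    {y : EuclideanSpace ℝ ι}
    (hy : ∀ z, inner ℝ (T y) (T z) = lam * ∑ i, y i * z i / d i) :
    ∑ i, y i ^ 2 / d i ≤
      (1 + 4 * (δ + 2 * C ^ 2 / lam) ^ 2 / g + 16 * C ^ 2 / lam) * (y k ^ 2 / d k) := by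
  set η := δ + 2 * C ^ 2 / lam with hη_def
  have hη0 : 0 ≤ η := by positivity
  set a := coordRestrict s y with ha
  set b := coordRestrict sᶜ y with hb
  have hab : y = a + b := (coordRestrict_add_compl s y).symm
  have hasq : ‖a‖ ^ 2 = ∑ i ∈ s, y i ^ 2 := norm_coordRestrict_sq s y
  have hbsq : ‖b‖ ^ 2 = ∑ i ∈ sᶜ, y i ^ 2 := norm_coordRestrict_sq sᶜ y
  -- the non-spiked part is small
  have hb1 : ‖b‖ ≤ 2 * C / lam * ‖a‖ := by
    have h1 : inner ℝ (T y) (T b) = lam * ‖b‖ ^ 2 := by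
      rw [hy, hbsq]
      congr 1
      rw [← Finset.sum_subset (Finset.subset_univ sᶜ)]
      · refine Finset.sum_congr rfl fun i hi => ?_
        rw [hb, coordRestrict_apply, if_pos hi, hd1 i (Finset.mem_compl.1 hi)]; ring
      · intro i _ hi
        rw [hb, coordRestrict_apply, if_neg hi]; simp
    rw [hab, map_add, inner_add_left] at h1
    have h2 := (le_abs_self _).trans (hT2 a b)
    have h3 := (le_abs_self _).trans (hT2 b b)
    rw [div_mul_eq_mul_div, le_div_iff₀ hlam]
    rcases (norm_nonneg b).eq_or_lt with h0 | h0
    · rw [← h0, zero_mul]; positivity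
    · have h4 : lam * ‖b‖ ≤ C * ‖a‖ + C * ‖b‖ := by
        refine le_of_mul_le_mul_right ?_ h0
        nlinarith
      nlinarith
  -- the spiked part concentrates on the coordinate `k`
  have hsum : ∑ i ∈ s, (1 - lam / d i) ^ 2 * y i ^ 2 ≤ η ^ 2 * ‖a‖ ^ 2 := by
    -- Chosen so that `⟨a, z⟩ - lam * ∑ y i * z i / d i` is exactly `‖z‖ ^ 2`; the near-isometry on
    -- `s` and the smallness of `b` bound it by `η * ‖a‖ * ‖z‖`.
    let z : EuclideanSpace ℝ ι :=
      coordRestrict s (WithLp.toLp 2 fun i => (1 - lam / d i) * y i)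
    have hz : ∀ i, z i = if i ∈ s then (1 - lam / d i) * y i else 0 := fun i => rfl
    have hzsq : ‖z‖ ^ 2 = ∑ i ∈ s, (1 - lam / d i) ^ 2 * y i ^ 2 := by
      rw [norm_coordRestrict_sq]
      exact Finset.sum_congr rfl fun i _ => mul_pow _ _ _
    have h1 : inner ℝ a z - inner ℝ (T y) (T z) = ‖z‖ ^ 2 := by
      rw [hy, PiLp.inner_apply, hzsq, Finset.mul_sum, ← Finset.sum_sub_distrib,
        ← Finset.sum_subset (Finset.subset_univ s)]
      · refine Finset.sum_congr rfl fun i hi => ?_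
        rw [hz, if_pos hi, ha, coordRestrict_apply, if_pos hi]
        simp only [RCLike.inner_apply, conj_trivial]
        ring
      · intro i _ hi
        rw [hz, if_neg hi]; simp
    have h2 := (abs_le.1 (hT1 a z (fun i hi => by rw [ha, coordRestrict_apply, if_neg hi])
      (fun i hi => by rw [hz, if_neg hi]))).1
    have h3 := (abs_le.1 (hT2 b z)).1
    rw [hab, map_add, inner_add_left] at h1
    have h4 : ‖z‖ ^ 2 ≤ η * ‖a‖ * ‖z‖ := by
      have h5 : C * ‖b‖ * ‖z‖ ≤ C * (2 * C / lam * ‖a‖) * ‖z‖ := by gcongr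
      have h6 : C * (2 * C / lam * ‖a‖) * ‖z‖ = 2 * C ^ 2 / lam * ‖a‖ * ‖z‖ := by ring
      rw [hη_def]
      linarith
    have h7 : ‖z‖ ≤ η * ‖a‖ := by
      rcases (norm_nonneg z).eq_or_lt with h0 | h0
      · rw [← h0]; positivity
      · refine le_of_mul_le_mul_right ?_ h0
        rwa [← sq]
    rw [← hzsq, ← mul_pow]
    gcongr
  have hsplit : ∀ f : ι → ℝ, ∑ i ∈ s, f i = f k + ∑ i ∈ s.erase k, f i := fun f =>
    (Finset.add_sum_erase s f hk).symm
  have hsum' : ∑ i ∈ s.erase k, (1 - lam / d i) ^ 2 * y i ^ 2 ≤ η ^ 2 * ‖a‖ ^ 2 := by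
    refine le_trans ?_ hsum
    rw [hsplit]
    linarith [mul_nonneg (sq_nonneg (1 - lam / d k)) (sq_nonneg (y k))]
  have hmem : ∀ i ∈ s.erase k, i ∈ s ∧ i ≠ k := fun i hi =>
    ⟨Finset.mem_of_mem_erase hi, Finset.ne_of_mem_erase hi⟩
  -- The first gap inequality and `η ^ 2 ≤ g / 2` leave at most half of `‖a‖ ^ 2` off `k`.
  have hak : ‖a‖ ^ 2 ≤ 2 * y k ^ 2 := by
    have h1 : g * ∑ i ∈ s.erase k, y i ^ 2 ≤ η ^ 2 * ‖a‖ ^ 2 := by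
      refine le_trans ?_ hsum'
      rw [Finset.mul_sum]
      refine Finset.sum_le_sum fun i hi => ?_
      exact mul_le_mul_of_nonneg_right (hgap i (hmem i hi).1 (hmem i hi).2).1 (sq_nonneg _)
    have h2 : η ^ 2 * ‖a‖ ^ 2 ≤ g / 2 * ‖a‖ ^ 2 :=
      mul_le_mul_of_nonneg_right hη (sq_nonneg _)
    have h3 := hsplit fun i => y i ^ 2
    rw [← hasq] at h3
    have h4 : ∑ i ∈ s.erase k, y i ^ 2 ≤ ‖a‖ ^ 2 / 2 := by
      refine le_of_mul_le_mul_left ?_ hg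
      linarith
    linarith
  have hdk0 := hd k
  have hw0 : 0 ≤ y k ^ 2 / d k := div_nonneg (sq_nonneg _) hdk0.le
  have hyk : y k ^ 2 ≤ 2 * lam * (y k ^ 2 / d k) := by
    calc y k ^ 2 = d k * (y k ^ 2 / d k) := by field_simp
      _ ≤ _ := by gcongr
  -- The second gap inequality is needed here: dividing by a spike `d i` much smaller than `lam`
  -- magnifies `y i ^ 2`, and the factor `lam / d i` compensates.
  have hspike : ∑ i ∈ s.erase k, y i ^ 2 / d i ≤ 4 * η ^ 2 / g * (y k ^ 2 / d k) := by
    have h1 : g * lam * ∑ i ∈ s.erase k, y i ^ 2 / d i ≤ η ^ 2 * ‖a‖ ^ 2 := by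
      refine le_trans ?_ hsum'
      rw [Finset.mul_sum]
      refine Finset.sum_le_sum fun i hi => ?_
      calc g * lam * (y i ^ 2 / d i) = g * (lam / d i) * y i ^ 2 := by ring
        _ ≤ _ := mul_le_mul_of_nonneg_right (hgap i (hmem i hi).1 (hmem i hi).2).2 (sq_nonneg _)
    have h2 : η ^ 2 * ‖a‖ ^ 2 ≤ η ^ 2 * (2 * (2 * lam * (y k ^ 2 / d k))) := by
      gcongr; linarith
    refine le_of_mul_le_mul_left ((h1.trans h2).trans (le_of_eq ?_)) (by positivity : 0 < g * lam)
    field_simp; ring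
  have hrest : ∑ i ∈ sᶜ, y i ^ 2 / d i ≤ 16 * C ^ 2 / lam * (y k ^ 2 / d k) := by
    have h1 : ∑ i ∈ sᶜ, y i ^ 2 / d i = ‖b‖ ^ 2 := by
      rw [hbsq]
      refine Finset.sum_congr rfl fun i hi => ?_
      rw [hd1 i (Finset.mem_compl.1 hi), div_one]
    rw [h1]
    calc ‖b‖ ^ 2 ≤ (2 * C / lam * ‖a‖) ^ 2 := by gcongr
      _ = (2 * C / lam) ^ 2 * ‖a‖ ^ 2 := mul_pow _ _ _
      _ ≤ (2 * C / lam) ^ 2 * (2 * (2 * lam * (y k ^ 2 / d k))) := by gcongr; linarith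
      _ = _ := by field_simp; ring
  rw [← Finset.sum_add_sum_compl s, hsplit]
  linarith

end Eigenvector

/-! ### Sample eigenvalues and eigenvectors of the spiked model -/

section SpikedModel

variable {N M n : ℕ}

theorem exists_orthonormalBasis_columnVector {U : Matrix (Fin N) (Fin N) ℝ}
    (hU : U ∈ Matrix.orthogonalGroup (Fin N) ℝ) :
    ∃ u : OrthonormalBasis (Fin N) ℝ (EuclideanSpace ℝ (Fin N)), ∀ i, u i = columnVector U i := by
  have hon : Orthonormal ℝ (columnVector U) := by
    rw [orthonormal_iff_ite]
    intro i j
    have h := congrFun (congrFun ((Matrix.mem_orthogonalGroup_iff' _ _).1 hU) j) i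
    rw [Matrix.mul_apply, Matrix.one_apply] at h
    simp only [columnVector, PiLp.inner_apply, RCLike.inner_apply, conj_trivial,
      Matrix.transpose_apply] at h ⊢
    rw [h]
    simp [eq_comm]
  have h1 : Orthonormal ℝ (Set.univ.domRestrict (columnVector U)) :=
    hon.comp _ Subtype.val_injective
  obtain ⟨u, hu⟩ := h1.exists_orthonormalBasis_extension_of_card_eq (by simp)
  exact ⟨u, fun i => hu i (Set.mem_univ i)⟩

theorem inner_sampleCovariance (X : Matrix (Fin N) (Fin n) ℝ) (x y : EuclideanSpace ℝ (Fin N)) :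
    inner ℝ (Matrix.toEuclideanLin (sampleCovariance X) x) y
      = inner ℝ (gramMap X x) (gramMap X y) := by
  rw [inner_gramMap, PiLp.inner_apply]
  have h : ∀ a, Matrix.toEuclideanLin (sampleCovariance X) x a
      = (1 / (n : ℝ)) * ∑ j, X a j * ∑ b, x b * X b j := by
    intro a
    simp only [sampleCovariance, Matrix.toLpLin_apply, Matrix.smul_mulVec, ← Matrix.mulVec_mulVec]
    simp [Matrix.mulVec, dotProduct, mul_comm, -Matrix.mulVec_mulVec]
  simp only [h, RCLike.inner_apply, conj_trivial]
  have h2 : ∀ a, y a * (1 / (n : ℝ) * ∑ j, X a j * ∑ b, x b * X b j)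
      = ∑ j, (∑ b, x b * X b j) * (y a * X a j) / n := by
    intro a
    rw [← mul_assoc, Finset.mul_sum]
    exact Finset.sum_congr rfl fun j _ => by ring
  simp_rw [h2]
  rw [Finset.sum_comm, Finset.sum_div]
  refine Finset.sum_congr rfl fun j _ => ?_
  rw [← Finset.sum_div, Finset.mul_sum]

/-- The vector `diag(√d) Uᵀ x`. -/
noncomputable def rescaledCoords (U : Matrix (Fin N) (Fin N) ℝ) (d : Fin N → ℝ)
    (x : EuclideanSpace ℝ (Fin N)) : EuclideanSpace ℝ (Fin N) :=
  WithLp.toLp 2 fun i => √(d i) * inner ℝ (columnVector U i) x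

theorem rescaledCoords_apply (U : Matrix (Fin N) (Fin N) ℝ) (d : Fin N → ℝ)
    (x : EuclideanSpace ℝ (Fin N)) (i : Fin N) :
    rescaledCoords U d x i = √(d i) * inner ℝ (columnVector U i) x := rfl

theorem gramMap_mul_diagonal_mul (U : Matrix (Fin N) (Fin N) ℝ) (d : Fin N → ℝ)
    (Z : Matrix (Fin N) (Fin n) ℝ) (x : EuclideanSpace ℝ (Fin N)) :
    gramMap (U * Matrix.diagonal (fun i => √(d i)) * Z) x = gramMap Z (rescaledCoords U d x) := by
  ext j
  rw [gramMap_apply, gramMap_apply]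
  congr 1
  have h : ∀ a, (U * Matrix.diagonal (fun i => √(d i)) * Z) a j = ∑ i, U a i * √(d i) * Z i j :=
    fun a => by rw [Matrix.mul_apply]; simp only [Matrix.mul_diagonal]
  simp_rw [h, rescaledCoords_apply, Finset.mul_sum]
  rw [Finset.sum_comm]
  refine Finset.sum_congr rfl fun i _ => ?_
  simp only [columnVector, PiLp.inner_apply, RCLike.inner_apply, conj_trivial]
  rw [Finset.mul_sum, Finset.sum_mul]
  exact Finset.sum_congr rfl fun a _ => by ring

theorem Fin.sum_eq_sum_castLE (h : M ≤ N) {f : Fin N → ℝ} (hf : ∀ i : Fin N, M ≤ i → f i = 0) :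
    ∑ i, f i = ∑ k : Fin M, f (Fin.castLE h k) := by
  refine (Fintype.sum_of_injective (Fin.castLE h) (Fin.castLE_injective h) _ _ (fun i hi => ?_)
    fun _ => rfl).symm
  refine hf i (not_lt.1 fun hlt => hi ⟨⟨i, hlt⟩, rfl⟩)

theorem abs_inner_gramMap_sub_inner_le_of_submatrix (h : M ≤ N) (Z : Matrix (Fin N) (Fin n) ℝ)
    {δ : ℝ}
    (hZ : ∀ x y, |inner ℝ (gramMap (Z.submatrix (Fin.castLE h) id) x)
        (gramMap (Z.submatrix (Fin.castLE h) id) y) - inner ℝ x y| ≤ δ * ‖x‖ * ‖y‖)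
    {x y : EuclideanSpace ℝ (Fin N)} (hx : ∀ i : Fin N, M ≤ i → x i = 0)
    (hy : ∀ i : Fin N, M ≤ i → y i = 0) :
    |inner ℝ (gramMap Z x) (gramMap Z y) - inner ℝ x y| ≤ δ * ‖x‖ * ‖y‖ := by
  let r : EuclideanSpace ℝ (Fin N) → EuclideanSpace ℝ (Fin M) := fun x =>
    WithLp.toLp 2 fun k => x (Fin.castLE h k)
  have hT : ∀ x : EuclideanSpace ℝ (Fin N), (∀ i : Fin N, M ≤ i → x i = 0) →
      gramMap Z x = gramMap (Z.submatrix (Fin.castLE h) id) (r x) := fun x hx => by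
    ext j
    rw [gramMap_apply, gramMap_apply, Fin.sum_eq_sum_castLE h fun i hi => by rw [hx i hi, zero_mul]]
    rfl
  have hn : ∀ x : EuclideanSpace ℝ (Fin N), (∀ i : Fin N, M ≤ i → x i = 0) → ‖x‖ = ‖r x‖ :=
    fun x hx => by
    rw [EuclideanSpace.norm_eq, EuclideanSpace.norm_eq,
      Fin.sum_eq_sum_castLE h fun i hi => by rw [hx i hi]; simp]
  have hi : inner ℝ x y = inner ℝ (r x) (r y) := by
    rw [PiLp.inner_apply, PiLp.inner_apply,
      Fin.sum_eq_sum_castLE h fun i hi => by rw [hx i hi]; simp]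
  rw [hT x hx, hT y hy, hn x hx, hn y hy, hi]
  exact hZ _ _

theorem abs_inner_map_le {E F : Type*} [NormedAddCommGroup E] [InnerProductSpace ℝ E]
    [NormedAddCommGroup F] [InnerProductSpace ℝ F] (T : E →L[ℝ] F) {C : ℝ} (hC : 0 ≤ C)
    (hT : ∀ x, ‖T x‖ ^ 2 ≤ C * ‖x‖ ^ 2) (x y : E) :
    |inner ℝ (T x) (T y)| ≤ C * ‖x‖ * ‖y‖ := by
  have h : ∀ x, ‖T x‖ ≤ √C * ‖x‖ := fun x => by
    refine le_of_sq_le_sq ?_ (by positivity)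
    rw [mul_pow, Real.sq_sqrt hC]
    exact hT x
  calc |inner ℝ (T x) (T y)| ≤ ‖T x‖ * ‖T y‖ := abs_real_inner_le_norm _ _
    _ ≤ (√C * ‖x‖) * (√C * ‖y‖) := by gcongr <;> exact h _
    _ = √C ^ 2 * ‖x‖ * ‖y‖ := by ring
    _ = _ := by rw [Real.sq_sqrt hC]

theorem spikedSpectrum_castLE (h : M ≤ N) (l : Fin M → ℝ) (k : Fin M) :
    spikedSpectrum N l (Fin.castLE h k) = l k := by
  simp [spikedSpectrum]

theorem spikedSpectrum_of_le (l : Fin M → ℝ) {i : Fin N} (hi : M ≤ i) :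
    spikedSpectrum N l i = 1 := by
  simp [spikedSpectrum, hi.not_gt]

theorem one_le_spikedSpectrum {l : Fin M → ℝ} (hl : ∀ k, 1 ≤ l k) (i : Fin N) :
    1 ≤ spikedSpectrum N l i := by
  unfold spikedSpectrum
  split_ifs
  exacts [hl _, le_rfl]

theorem spikedSpectrum_antitone {l : Fin M → ℝ} (hl : Antitone l) (hl1 : ∀ k, 1 ≤ l k) :
    Antitone (spikedSpectrum N l) := by
  intro i j hij
  unfold spikedSpectrum
  have hij' : (i : ℕ) ≤ j := hij
  split_ifs with h1 h2
  · exact hl hij'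
  · omega
  · exact hl1 _
  · exact le_rfl

/-- Here `a` is the sample eigenvalue, `b` its spike and `d` another spike. The ratio `r = a / d` is
at least `ε / 4` away from `1`; if `r ≥ 1 + ε / 4`, then also `r - 1 ≥ ε / 5 * r` because `ε ≤ 1`.
-/
theorem one_sub_div_sq_ge {ε a d b : ℝ} (hε : 0 < ε) (hε1 : ε ≤ 1) (hb : 0 < b) (hd : 0 < d)
    (h1 : (1 - ε / 4) * b ≤ a) (h2 : a ≤ (1 + ε / 4) * b)
    (hgap : (1 + ε) * b ≤ d ∨ (1 + ε) * d ≤ b) :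
    ε ^ 2 / 25 ≤ (1 - a / d) ^ 2 ∧ ε ^ 2 / 25 * (a / d) ≤ (1 - a / d) ^ 2 := by
  set r := a / d with hr
  have har : a = r * d := by rw [hr]; field_simp
  rcases hgap with h | h
  · have h3 : r ≤ 1 - ε / 4 := by
      rw [hr, div_le_iff₀ hd]
      nlinarith
    constructor <;> nlinarith
  · have h3 : 1 + ε / 4 ≤ r := by
      rw [hr, le_div_iff₀ hd]
      nlinarith
    have h4 : ε / 5 * r ≤ r - 1 := by nlinarith
    have h5 : ε / 5 ≤ r - 1 := by linarith
    constructor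
    · nlinarith
    · have h6 : 0 ≤ ε / 5 := by positivity
      have h7 : ε / 5 * (ε / 5 * r) ≤ (r - 1) * (r - 1) := by
        exact mul_le_mul h5 h4 (mul_nonneg h6 (by linarith)) (by linarith)
      nlinarith

variable {Sigma U : Matrix (Fin N) (Fin N) ℝ} {l : Fin M → ℝ} {X Z : Matrix (Fin N) (Fin n) ℝ}

/-- On the event where the spiked rows of `Z` are nearly orthonormal and `Z` is bounded, the sample
eigenvalue of a large spike is close to the spike. -/
theorem sampleEigenvalue_bounds (h : IsSpikedCovariance Sigma l U)
    (hX : X = U * Matrix.diagonal (fun i => √(spikedSpectrum N l i)) * Z) {δ C : ℝ}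
    (hδ : 0 < δ) (hδ1 : δ ≤ 1)
    (hT1 : ∀ x y : EuclideanSpace ℝ (Fin N), (∀ i : Fin N, M ≤ i → x i = 0) →
      (∀ i : Fin N, M ≤ i → y i = 0) →
      |inner ℝ (gramMap Z x) (gramMap Z y) - inner ℝ x y| ≤ δ * ‖x‖ * ‖y‖)
    (hT2 : ∀ x y, |inner ℝ (gramMap Z x) (gramMap Z y)| ≤ C * ‖x‖ * ‖y‖)
    (k : Fin M) (hk : C ^ 2 / δ + C ≤ l k) :
    (1 - δ) * l k ≤ sampleEigenvalue X (Fin.castLE h.le k) ∧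
      sampleEigenvalue X (Fin.castLE h.le k) ≤ (1 + 2 * δ) * l k := by
  obtain ⟨u, hu⟩ := exists_orthonormalBasis_columnVector h.orthogonal
  set d := spikedSpectrum N l with hd
  have hdk : d (Fin.castLE h.le k) = l k := spikedSpectrum_castLE h.le l k
  have hd1 : ∀ i, 1 ≤ d i := one_le_spikedSpectrum h.one_le
  have hanti : Antitone d := spikedSpectrum_antitone h.antitone h.one_le
  let v := ((Matrix.isSymmetric_toEuclideanLin_iff.mpr
    (sampleCovariance_isHermitian X)).eigenvectorBasis finrank_euclideanSpace).reindex
      (finCongr (Fintype.card_fin N))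
  have hv : ∀ j, Matrix.toEuclideanLin (sampleCovariance X) (v j) = sampleEigenvalue X j • v j := by
    intro j
    simp only [v, OrthonormalBasis.reindex_apply]
    exact LinearMap.IsSymmetric.apply_eigenvectorBasis _ _ _
  have hμ : Antitone (sampleEigenvalue X) := fun i j hij =>
    (sampleCovariance_isHermitian X).eigenvalues₀_antitone (by exact hij)
  have hS : ∀ x, inner ℝ (Matrix.toEuclideanLin (sampleCovariance X) x) x
      = ‖gramMap Z (rescaledCoords U d x)‖ ^ 2 := fun x => by
    rw [inner_sampleCovariance, hX, gramMap_mul_diagonal_mul, real_inner_self_eq_norm_sq]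
  have hysq : ∀ x i, rescaledCoords U d x i ^ 2 = d i * inner ℝ (u i) x ^ 2 := fun x i => by
    rw [rescaledCoords_apply, mul_pow, Real.sq_sqrt (zero_le_one.trans (hd1 i)), hu]
  rw [← hdk]
  have hkM : ((Fin.castLE h.le k : Fin N) : ℕ) < M := k.2
  set k' := Fin.castLE h.le k with hk'
  constructor
  -- Vectors in the span of the first population eigenvectors up to `k` have only spiked
  -- coordinates, so the near-isometry applies directly.
  · refine le_eigenvalue_of_forall_le hv hμ u k' fun x hx => ?_
    rw [hS]
    set y := rescaledCoords U d x with hy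
    have hysupp : ∀ i : Fin N, M ≤ i → y i = 0 := fun i hi => by
      rw [hy, rescaledCoords_apply, ← hu, hx i (Fin.lt_def.2 (by omega)), mul_zero]
    have h1 := (abs_le.1 (hT1 y y hysupp hysupp)).1
    rw [real_inner_self_eq_norm_sq, real_inner_self_eq_norm_sq] at h1
    have h2 : d k' * ‖x‖ ^ 2 ≤ ‖y‖ ^ 2 := by
      rw [norm_sq_eq_sum_inner_sq u, EuclideanSpace.real_norm_sq_eq, Finset.mul_sum]
      refine Finset.sum_le_sum fun i _ => ?_
      rw [hysq]
      rcases lt_or_ge k' i with hi | hi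
      · rw [hx i hi]; simp
      · exact mul_le_mul_of_nonneg_right (hanti hi) (sq_nonneg _)
    nlinarith
  · refine eigenvalue_le_of_forall_le hv hμ u k' fun x hx => ?_
    rw [hS]
    set y := rescaledCoords U d x with hy
    let s : Finset (Fin N) := Finset.univ.filter fun i => (i : ℕ) < M
    have hs : ∀ i, i ∈ s ↔ (i : ℕ) < M := fun i => by simp [s]
    set a := coordRestrict s y with ha
    set b := coordRestrict sᶜ y with hb
    have hab : y = a + b := (coordRestrict_add_compl s y).symm
    have hasupp : ∀ i : Fin N, M ≤ i → a i = 0 := fun i hi => by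
      rw [ha, coordRestrict_apply, if_neg (by rw [hs]; omega)]
    have h1 := (abs_le.1 (hT1 a a hasupp hasupp)).2
    have h2 := (abs_le.1 (hT2 a b)).2
    have h3 := (abs_le.1 (hT2 b b)).2
    rw [real_inner_self_eq_norm_sq, real_inner_self_eq_norm_sq] at h1
    rw [real_inner_self_eq_norm_sq] at h3
    -- The cross term is split by weighted AM-GM: it costs one more `δ` on the spiked part and `C ^
    -- 2 / δ` on the noise part, which the large spike absorbs.
    have h4 : ‖gramMap Z y‖ ^ 2 ≤ (1 + 2 * δ) * ‖a‖ ^ 2 + (C ^ 2 / δ + C) * ‖b‖ ^ 2 := by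
      rw [hab, map_add, norm_add_sq_real]
      have h5 : 2 * (C * ‖a‖ * ‖b‖) ≤ δ * ‖a‖ ^ 2 + C ^ 2 / δ * ‖b‖ ^ 2 := by
        have h6 : 0 ≤ (δ * ‖a‖ - C * ‖b‖) ^ 2 / δ := by positivity
        have h7 : (δ * ‖a‖ - C * ‖b‖) ^ 2 / δ
            = δ * ‖a‖ ^ 2 + C ^ 2 / δ * ‖b‖ ^ 2 - 2 * (C * ‖a‖ * ‖b‖) := by field_simp; ring
        linarith
      nlinarith
    have h8 : ‖a‖ ^ 2 ≤ d k' * ∑ i ∈ s, inner ℝ (u i) x ^ 2 := by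
      rw [norm_coordRestrict_sq, Finset.mul_sum]
      refine Finset.sum_le_sum fun i _ => ?_
      rw [hysq]
      rcases lt_or_ge i k' with hi | hi
      · rw [hx i hi]; simp
      · exact mul_le_mul_of_nonneg_right (hanti hi) (sq_nonneg _)
    have h9 : ‖b‖ ^ 2 = ∑ i ∈ sᶜ, inner ℝ (u i) x ^ 2 := by
      rw [norm_coordRestrict_sq]
      refine Finset.sum_congr rfl fun i hi => ?_
      rw [Finset.mem_compl, hs, not_lt] at hi
      rw [hysq, hd, spikedSpectrum_of_le l hi, one_mul]
    rw [norm_sq_eq_sum_inner_sq u x, ← Finset.sum_add_sum_compl s, ← h9]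
    have h10 : C ^ 2 / δ + C ≤ (1 + 2 * δ) * d k' := by
      rw [hdk]
      nlinarith [h.one_le k]
    calc _ ≤ _ := h4
      _ ≤ (1 + 2 * δ) * (d k' * ∑ i ∈ s, inner ℝ (u i) x ^ 2)
          + (1 + 2 * δ) * d k' * ‖b‖ ^ 2 := by gcongr
      _ = _ := by ring

/-- Localization of the sample eigenvector of a large separated spike. -/
theorem one_le_mul_inner_columnVector_sq (h : IsSpikedCovariance Sigma l U)
    (hX : X = U * Matrix.diagonal (fun i => √(spikedSpectrum N l i)) * Z) {δ C ε : ℝ}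
    (hδ : 0 < δ) (hδε : δ ≤ ε / 8) (hC : 0 ≤ C) (hε : 0 < ε) (hε1 : ε ≤ 1)
    (hZ1 : ∀ x y, |inner ℝ (gramMap (Z.submatrix (Fin.castLE h.le) id) x)
        (gramMap (Z.submatrix (Fin.castLE h.le) id) y) - inner ℝ x y| ≤ δ * ‖x‖ * ‖y‖)
    (hZ2 : ∀ x, ‖gramMap Z x‖ ^ 2 ≤ C * ‖x‖ ^ 2)
    (k : Fin M) (hk : C ^ 2 / δ + 4 * C ≤ l k)
    (hη : (δ + 4 * C ^ 2 / l k) ^ 2 ≤ ε ^ 2 / 50)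
    (hbefore : ∀ i, i < k → (1 + ε) * l k ≤ l i) (hafter : ∀ i, k < i → (1 + ε) * l i ≤ l k)
    {p : EuclideanSpace ℝ (Fin N)} (hp1 : ‖p‖ = 1)
    (hp : Matrix.toEuclideanLin (sampleCovariance X) p
      = sampleEigenvalue X (Fin.castLE h.le k) • p) :
    1 ≤ (1 + 100 * (δ + 4 * C ^ 2 / l k) ^ 2 / ε ^ 2 + 32 * C ^ 2 / l k) *
      inner ℝ p (columnVector U (Fin.castLE h.le k)) ^ 2 := by
  have hT1 : ∀ x y : EuclideanSpace ℝ (Fin N), (∀ i : Fin N, M ≤ i → x i = 0) →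
      (∀ i : Fin N, M ≤ i → y i = 0) →
      |inner ℝ (gramMap Z x) (gramMap Z y) - inner ℝ x y| ≤ δ * ‖x‖ * ‖y‖ :=
    fun x y => abs_inner_gramMap_sub_inner_le_of_submatrix h.le Z hZ1
  have hT2 := abs_inner_map_le (gramMap Z) hC hZ2
  have hlk := h.one_le k
  have hlk0 : 0 < l k := by linarith
  obtain ⟨hlo, hhi⟩ := sampleEigenvalue_bounds h hX hδ (by linarith) hT1 hT2 k (by linarith)
  set lam := sampleEigenvalue X (Fin.castLE h.le k) with hlam_def
  have hlam2 : l k ≤ 2 * lam := by nlinarith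
  have hlam : 0 < lam := by linarith
  obtain ⟨u, hu⟩ := exists_orthonormalBasis_columnVector h.orthogonal
  set d := spikedSpectrum N l with hd
  have hdk : d (Fin.castLE h.le k) = l k := spikedSpectrum_castLE h.le l k
  have hd1 : ∀ i, 1 ≤ d i := one_le_spikedSpectrum h.one_le
  have hd0 : ∀ i, 0 < d i := fun i => zero_lt_one.trans_le (hd1 i)
  let s : Finset (Fin N) := Finset.univ.filter fun i => (i : ℕ) < M
  have hs : ∀ i, i ∈ s ↔ (i : ℕ) < M := fun i => by simp [s]
  have hs' : ∀ i : Fin N, M ≤ i → i ∉ s := fun i hi => by rw [hs]; omega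
  have hCδ : 0 ≤ C ^ 2 / δ := by positivity
  have hfrac : 2 * C ^ 2 / lam ≤ 4 * C ^ 2 / l k := by
    rw [div_le_div_iff₀ hlam hlk0]
    nlinarith [sq_nonneg C]
  have hfrac0 : 0 ≤ 2 * C ^ 2 / lam := by positivity
  have hηle : (δ + 2 * C ^ 2 / lam) ^ 2 ≤ (δ + 4 * C ^ 2 / l k) ^ 2 := by gcongr
  have hmain := sum_sq_div_le_of_inner_map_eq (s := s) (k := Fin.castLE h.le k)
    (by rw [hs]; exact k.2) hd0
    (fun i hi => by rw [hs, not_lt] at hi; exact spikedSpectrum_of_le l hi) (gramMap Z) hδ.le hC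
    hlam (by linarith) (g := ε ^ 2 / 25) (by positivity)
    (fun x y hx hy => hT1 x y (fun i hi => hx i (hs' i hi)) (fun i hi => hy i (hs' i hi))) hT2
    (fun i hi hik => by
      rw [hs] at hi
      have hdi : d i = l ⟨i, hi⟩ := spikedSpectrum_castLE h.le l ⟨i, hi⟩
      refine one_sub_div_sq_ge hε hε1 hlk0 (hd0 i) (by nlinarith) (by nlinarith) ?_
      rw [hdi]
      have hne : (⟨i, hi⟩ : Fin M) ≠ k := fun he => hik (by rw [← he]; rfl)
      rcases lt_or_gt_of_ne hne with hlt | hlt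
      · exact Or.inl (hbefore _ hlt)
      · exact Or.inr (hafter _ hlt))
    (by linarith) (by rw [hdk]; exact hlam2) (y := rescaledCoords U d p)
    (fun z => by
      -- The preimage of `z` under the rescaling; pairing the eigenvector equation with it gives the
      -- required identity.
      let x : EuclideanSpace ℝ (Fin N) := ∑ i, (z i / √(d i)) • u i
      have hsq : ∀ i, √(d i) ≠ 0 := fun i => (Real.sqrt_pos.2 (hd0 i)).ne'
      have hRx : rescaledCoords U d x = z := by
        ext i
        rw [rescaledCoords_apply, ← hu, u.orthonormal.inner_right_fintype,
          mul_div_cancel₀ _ (hsq i)]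
      have h1 : inner ℝ (Matrix.toEuclideanLin (sampleCovariance X) p) x
          = inner ℝ (gramMap Z (rescaledCoords U d p)) (gramMap Z z) := by
        rw [inner_sampleCovariance, hX, gramMap_mul_diagonal_mul, gramMap_mul_diagonal_mul, hRx]
      rw [← h1, hp, real_inner_smul_left, inner_sum]
      congr 1
      refine Finset.sum_congr rfl fun i _ => ?_
      rw [real_inner_smul_right, rescaledCoords_apply, ← hu, real_inner_comm]
      have := Real.mul_self_sqrt (hd0 i).le
      have hdi := (hd0 i).ne'
      rw [div_mul_eq_mul_div, div_eq_div_iff (hsq i) hdi]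
      nth_rw 1 [← this]
      ring)
  have hq : ∀ i, rescaledCoords U d p i ^ 2 / d i = inner ℝ (u i) p ^ 2 := fun i => by
    rw [rescaledCoords_apply, mul_pow, Real.sq_sqrt (hd0 i).le, hu,
      mul_div_cancel_left₀ _ (hd0 i).ne']
  simp_rw [hq] at hmain
  rw [← norm_sq_eq_sum_inner_sq u, hp1, one_pow, hu, real_inner_comm] at hmain
  refine hmain.trans (mul_le_mul_of_nonneg_right ?_ (sq_nonneg _))
  have e1 : 4 * (δ + 2 * C ^ 2 / lam) ^ 2 / (ε ^ 2 / 25)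
      = 100 * (δ + 2 * C ^ 2 / lam) ^ 2 / ε ^ 2 := by field_simp; ring
  have e2 : 100 * (δ + 2 * C ^ 2 / lam) ^ 2 / ε ^ 2
      ≤ 100 * (δ + 4 * C ^ 2 / l k) ^ 2 / ε ^ 2 := by gcongr
  have e3 : 16 * C ^ 2 / lam = 8 * (2 * C ^ 2 / lam) := by ring
  have e4 : 32 * C ^ 2 / l k = 8 * (4 * C ^ 2 / l k) := by ring
  rw [e1, e3, e4]
  linarith

end SpikedModel

/-! ### Borel–Cantelli -/

section AlmostSure

variable {Ω : Type*} [MeasurableSpace Ω] {P : Measure Ω} [IsProbabilityMeasure P]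

theorem ae_eventually_of_measureReal_le_exp {Q : ℕ → Ω → Prop} {a r : ℝ} (hr : 0 < r)
    (h : ∀ᶠ n : ℕ in atTop, P.real {ω | ¬ Q n ω} ≤ a * Real.exp (-(r * n))) :
    ∀ᵐ ω ∂P, ∀ᶠ n in atTop, Q n ω := by
  have hsum : Summable fun n : ℕ => a * Real.exp (-(r * n)) := by
    refine Summable.mul_left a ?_
    have : ∀ n : ℕ, Real.exp (-(r * n)) = Real.exp (n * (-r)) := fun n => by ring_nf
    simp_rw [this]
    exact Real.summable_exp_nat_mul_iff.2 (neg_lt_zero.2 hr)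
  have hs : Summable fun n => P.real {ω | ¬ Q n ω} := by
    refine Summable.of_norm_bounded_eventually_nat hsum ?_
    filter_upwards [h] with n hn
    rwa [Real.norm_eq_abs, abs_of_nonneg measureReal_nonneg]
  have ht : ∑' n, P {ω | ¬ Q n ω} ≠ ∞ := by
    have := hs.tsum_ofReal_ne_top
    simpa only [ofReal_measureReal (measure_ne_top P _)] using this
  filter_upwards [ae_eventually_notMem ht] with ω hω
  filter_upwards [hω] with n hn
  simpa using hn

variable {c : NNReal} {m : ℕ → ℕ} {A : ∀ n, Ω → Matrix (Fin (m n)) (Fin n) ℝ}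

theorem ae_eventually_inner_gramMap_deviation_le (hA : ∀ n, IsSubgaussianMatrix P c (A n))
    (hc : 0 < c) (hm : Tendsto (fun n : ℕ => (m n : ℝ) / n) atTop (𝓝 0)) {δ : ℝ} (hδ : 0 < δ) :
    ∀ᵐ ω ∂P, ∀ᶠ n in atTop, ∀ x y,
      |inner ℝ (gramMap (A n ω) x) (gramMap (A n ω) y) - inner ℝ x y| ≤ δ * ‖x‖ * ‖y‖ := by
  have hc' : (0 : ℝ) < c := hc
  have hr : 0 < bernsteinRate (3 / (8 * c)) (δ / 4) := bernsteinRate_pos (by positivity)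
    (by positivity)
  set r := bernsteinRate (3 / (8 * c)) (δ / 4) with hr_def
  have hlog : 0 < Real.log 25 := Real.log_pos (by norm_num)
  refine ae_eventually_of_measureReal_le_exp (a := 4) (half_pos hr) ?_
  -- With this bound on `m n / n` the factor `25 ^ m n` uses up at most half of the rate `r`.
  filter_upwards [eventually_gt_atTop 0,
    hm.eventually_lt_const (show (0 : ℝ) < r / (2 * Real.log 25) by positivity)] with n hn hmn
  have hn' : (0 : ℝ) < n := by exact_mod_cast hn
  rw [div_lt_div_iff₀ hn' (by positivity)] at hmn
  have h := (hA n).measureReal_inner_gramMap_deviation_le hc hn (δ := δ / 4) (by positivity)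
  rw [mul_div_cancel₀ δ (by norm_num : (4 : ℝ) ≠ 0)] at h
  refine h.trans ?_
  rw [mul_assoc, ← hr_def, ← Real.exp_log (show (0 : ℝ) < 25 by norm_num), ← Real.exp_nat_mul,
    ← Real.exp_add]
  gcongr
  linarith

theorem exists_ae_eventually_norm_gramMap_le (hA : ∀ n, IsSubgaussianMatrix P c (A n))
    (hc : 0 < c) {γ : ℝ} (hγ : 0 < γ) (hm : ∀ n : ℕ, 1 ≤ n → (m n : ℝ) / n ≤ γ) :
    ∃ C : ℝ, 0 ≤ C ∧ ∀ᵐ ω ∂P, ∀ᶠ n in atTop, ∀ x,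
      ‖gramMap (A n ω) x‖ ^ 2 ≤ C * ‖x‖ ^ 2 := by
  have hc' : (0 : ℝ) < c := hc
  have hlog2 : 0 < Real.log 2 := Real.log_pos (by norm_num)
  have hlog : 0 < Real.log 5 := Real.log_pos (by norm_num)
  -- Solves `3 / (8 * c) * t = log 2 + γ * log 5 + 1`, so the net factor `5 ^ m n` still leaves `exp
  -- (-n)`.
  set t := (Real.log 2 + γ * Real.log 5 + 1) * (8 * c) / 3 with ht_def
  have ht : 0 ≤ t := by positivity
  have hθt : 3 / (8 * c) * t = Real.log 2 + γ * Real.log 5 + 1 := by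
    rw [ht_def]; field_simp
  refine ⟨4 * t, by positivity, ae_eventually_of_measureReal_le_exp (a := 1) one_pos ?_⟩
  filter_upwards [eventually_ge_atTop 1] with n hn
  have hn' : (0 : ℝ) < n := by exact_mod_cast hn
  have hmn := hm n hn
  rw [div_le_iff₀ hn'] at hmn
  refine ((hA n).measureReal_norm_gramMap_large_le hc hn ht).trans ?_
  have hpow : (5 : ℝ) ^ m n = Real.exp (m n * Real.log 5) := by
    rw [Real.exp_nat_mul, Real.exp_log (by norm_num)]
  rw [hθt, hpow, ← Real.exp_add, one_mul, Real.exp_le_exp]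
  nlinarith

end AlmostSure

/-! ### Spectral gaps and conclusion -/

theorem ENNReal.mul_le_of_lt_div_ofReal {a b c : ℝ} (ha : 0 ≤ a) (hb : 0 < b)
    (h : ENNReal.ofReal a < ENNReal.ofReal c / ENNReal.ofReal b) : a * b ≤ c := by
  rw [← ENNReal.ofReal_div_of_pos hb, ENNReal.ofReal_lt_ofReal_iff_of_nonneg ha,
    lt_div_iff₀ hb] at h
  exact h.le

theorem mul_le_of_lt_div_nextSpike {M : ℕ} {l : Fin M → ℝ} (hl : Antitone l) (hl1 : ∀ k, 1 ≤ l k)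
    {k : Fin M} {a : ℝ} (ha : 0 ≤ a)
    (h : ENNReal.ofReal a < ENNReal.ofReal (l k) / nextSpike l k) {i : Fin M} (hi : k < i) :
    a * l i ≤ l k := by
  have hi' : (k : ℕ) < i := hi
  have hlt : (k : ℕ) + 1 < M := by omega
  rw [nextSpike, dif_pos hlt] at h
  have h1 := ENNReal.mul_le_of_lt_div_ofReal ha (zero_lt_one.trans_le (hl1 _)) h
  refine le_trans (mul_le_mul_of_nonneg_left (hl ?_) ha) h1
  exact Fin.le_def.2 (by simpa using hi')

theorem mul_le_of_lt_prevSpike_div {M : ℕ} {l : Fin M → ℝ} (hl : Antitone l) (hl1 : ∀ k, 1 ≤ l k)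
    {k : Fin M} {a : ℝ} (ha : 0 ≤ a)
    (h : ENNReal.ofReal a < prevSpike l k / ENNReal.ofReal (l k)) {i : Fin M} (hi : i < k) :
    a * l k ≤ l i := by
  have hi' : (i : ℕ) < k := hi
  rw [prevSpike, if_neg (by omega)] at h
  refine (ENNReal.mul_le_of_lt_div_ofReal ha (zero_lt_one.trans_le (hl1 _)) h).trans (hl ?_)
  exact Fin.le_def.2 (by simp only; omega)

theorem IsSpikedSample.isSubgaussianMatrix {Ω : Type*} [MeasurableSpace Ω] {P : Measure Ω}
    [IsProbabilityMeasure P] {K : ℝ} (hK : 0 < K) {N M n : ℕ} {l : Fin M → ℝ}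
    {U : Matrix (Fin N) (Fin N) ℝ} {Z X : Ω → Matrix (Fin N) (Fin n) ℝ}
    (h : IsSpikedSample P K l U Z X) :
    IsSubgaussianMatrix P (Real.toNNReal (36 * K ^ 2)) Z where
  measurable := h.measurable
  indep := h.indep
  subgaussian i j := hasSubgaussianMGF_of_psiTwoNorm_le (h.measurable i j) (h.mean i j) hK
    (h.psiTwo i j) (by rw [Real.coe_toNNReal _ (by positivity)])
  mean := h.mean
  variance := h.variance

theorem tendsto_one_of_forall_one_le_mul {α : Type*} {f : Filter α} {q : α → ℝ}
    (hq1 : ∀ n, q n ≤ 1) {B : ℝ} (hB : 0 < B)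
    (h : ∀ m : ℕ, ∀ᶠ n in f, 1 ≤ (1 + B / (m + 1)) * q n) : Tendsto q f (𝓝 1) := by
  refine tendsto_order.2 ⟨fun a ha => ?_, fun a ha => Eventually.of_forall fun n =>
    (hq1 n).trans_lt ha⟩
  obtain ⟨m, hm⟩ := exists_nat_gt (B / (1 - a))
  have h1a : 0 < 1 - a := by linarith
  rw [div_lt_iff₀ h1a] at hm
  filter_upwards [h m] with n hn
  have h1 : B / (m + 1) < 1 - a := by
    rw [div_lt_iff₀ (by positivity)]
    nlinarith
  have h2 : B / (m + 1) * q n ≤ B / (m + 1) := mul_le_of_le_one_right (by positivity) (hq1 n)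
  linarith

theorem proposition2 {Ω : Type*} [MeasurableSpace Ω] (P : Measure Ω) [IsProbabilityMeasure P]
    (N M : ℕ → ℕ) (K γ : ℝ) (hK : 0 < K) (hγ : 0 < γ)
    (Sigma : ∀ n, Matrix (Fin (N n)) (Fin (N n)) ℝ)
    (l : ∀ n, Fin (M n) → ℝ)
    (U : ∀ n, Matrix (Fin (N n)) (Fin (N n)) ℝ)
    (Z X : ∀ n, Ω → Matrix (Fin (N n)) (Fin n) ℝ)
    (A1 : ∀ n, IsSpikedCovariance (Sigma n) (l n) (U n))
    (A2 : ∀ n, IsSpikedSample P K (l n) (U n) (Z n) (X n))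
    (A3 : ∀ n : ℕ, 1 ≤ n → 1 / γ ≤ (N n : ℝ) / n ∧ (N n : ℝ) / n ≤ γ)
    (A4 : Tendsto (fun n : ℕ => (M n : ℝ) / n) atTop (𝓝 0))
    (p : ∀ n, Ω → Fin (M n) → EuclideanSpace ℝ (Fin (N n)))
    (hp : ∀ n ω, IsLeadingEigenvectors (A1 n).le (X n ω) (p n ω))
    (ν : ∀ n, Fin (M n)) (ε₀ : ℝ) (hε₀ : 0 < ε₀)
    (hnext : ENNReal.ofReal (1 + ε₀) <
      liminf (fun n => ENNReal.ofReal (l n (ν n)) / nextSpike (l n) (ν n)) atTop)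
    (hprev : ENNReal.ofReal (1 + ε₀) <
      liminf (fun n => prevSpike (l n) (ν n) / ENNReal.ofReal (l n (ν n))) atTop)
    (hdiv : Tendsto (fun n => l n (ν n)) atTop atTop) :
    ∀ᵐ ω ∂P, Tendsto
      (fun n => (inner ℝ (p n ω (ν n))
        (columnVector (U n) (Fin.castLE (A1 n).le (ν n)))) ^ 2) atTop (𝓝 1) := by
  have hZ : ∀ n, IsSubgaussianMatrix P (Real.toNNReal (36 * K ^ 2)) (Z n) :=
    fun n => (A2 n).isSubgaussianMatrix hK
  have hc : 0 < Real.toNNReal (36 * K ^ 2) := Real.toNNReal_pos.2 (by positivity)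
  have hZ1 : ∀ n, IsSubgaussianMatrix P (Real.toNNReal (36 * K ^ 2))
      fun ω => (Z n ω).submatrix (Fin.castLE (A1 n).le) id :=
    fun n => (hZ n).submatrix (Fin.castLE_injective _)
  obtain ⟨C, hC, hF2⟩ := exists_ae_eventually_norm_gramMap_le hZ hc hγ fun n hn => (A3 n hn).2
  set ε := min ε₀ 1 with hε_def
  have hε : 0 < ε := lt_min hε₀ one_pos
  have hε1 : ε ≤ 1 := min_le_right _ _
  have hε2 : ε ≤ ε₀ := min_le_left _ _
  -- Countably many tolerances, so that one null set serves them all. The factor `1 / 16` yields `δ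
  -- m ≤ ε / 8` and `(2 * δ m) ^ 2 ≤ ε ^ 2 / 50`.
  let δ : ℕ → ℝ := fun m => ε / 16 / (m + 1)
  have hδ : ∀ m, 0 < δ m := fun m => by positivity
  have hδε : ∀ m, δ m ≤ ε / 16 := fun m =>
    div_le_self (by positivity) (by linarith [Nat.cast_nonneg (α := ℝ) m])
  have hF1 : ∀ᵐ ω ∂P, ∀ m, ∀ᶠ n in atTop, ∀ x y,
      |inner ℝ (gramMap ((Z n ω).submatrix (Fin.castLE (A1 n).le) id) x)
        (gramMap ((Z n ω).submatrix (Fin.castLE (A1 n).le) id) y) - inner ℝ x y|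
        ≤ δ m * ‖x‖ * ‖y‖ :=
    ae_all_iff.2 fun m => ae_eventually_inner_gramMap_deviation_le hZ1 hc A4 (hδ m)
  have hcol : ∀ n i, ‖columnVector (U n) i‖ = 1 := fun n i => by
    obtain ⟨u, hu⟩ := exists_orthonormalBasis_columnVector (A1 n).orthogonal
    rw [← hu, u.orthonormal.1]
  filter_upwards [hF1, hF2] with ω h1 h2
  -- Once `4 * C ^ 2 / l ≤ δ m`, the two error terms are at most `400 * δ m ^ 2 / ε ^ 2` and `8 * δ
  -- m`, hence `25 / 16` and `8` over `m + 1`.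
  refine tendsto_one_of_forall_one_le_mul (fun n => ?_)
    (B := 25 / 16 + 8) (by norm_num) fun m => ?_
  · rw [sq_le_one_iff_abs_le_one]
    refine (abs_real_inner_le_norm _ _).trans ?_
    rw [hcol, (hp n ω).norm_eq_one, one_mul]
  filter_upwards [h1 m, h2, eventually_lt_of_lt_liminf hnext, eventually_lt_of_lt_liminf hprev,
    hdiv.eventually_ge_atTop (C ^ 2 / δ m + 4 * C),
    hdiv.eventually_ge_atTop (4 * C ^ 2 / δ m)] with n g1 g2 g3 g4 g5 g6
  have hl1 := (A1 n).one_le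
  have hpos : 0 < l n (ν n) := zero_lt_one.trans_le (hl1 _)
  have hsmall : 4 * C ^ 2 / l n (ν n) ≤ δ m := by
    rw [div_le_iff₀ (hδ m)] at g6
    rw [div_le_iff₀ hpos]
    linarith
  have hsmall0 : 0 ≤ 4 * C ^ 2 / l n (ν n) := by positivity
  have hsq : (δ m + 4 * C ^ 2 / l n (ν n)) ^ 2 ≤ (2 * δ m) ^ 2 := by
    have := hδ m
    gcongr
    linarith
  have hδsq : δ m ^ 2 ≤ ε / 16 * δ m := by
    rw [sq]; exact mul_le_mul_of_nonneg_right (hδε m) (hδ m).le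
  have hη : (δ m + 4 * C ^ 2 / l n (ν n)) ^ 2 ≤ ε ^ 2 / 50 := by
    nlinarith [hδε m]
  have key := one_le_mul_inner_columnVector_sq (A1 n) ((A2 n).eq ω) (hδ m)
    (by linarith [hδε m]) hC hε hε1 g1 g2 (ν n) g5 hη
    (fun i hi => le_trans (mul_le_mul_of_nonneg_right (by linarith) hpos.le)
      (mul_le_of_lt_prevSpike_div (A1 n).antitone hl1 (by positivity) g4 hi))
    (fun i hi => le_trans
      (mul_le_mul_of_nonneg_right (by linarith) (zero_le_one.trans (hl1 i)))
      (mul_le_of_lt_div_nextSpike (A1 n).antitone hl1 (by positivity) g3 hi))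
    ((hp n ω).norm_eq_one _) ((hp n ω).eigen _)
  refine key.trans (mul_le_mul_of_nonneg_right ?_ (sq_nonneg _))
  have e1 : 100 * (δ m + 4 * C ^ 2 / l n (ν n)) ^ 2 / ε ^ 2 ≤ 25 / 16 / (m + 1) := by
    have e : (25 / 16 : ℝ) / (m + 1) = 100 * (4 * (ε / 16 * δ m)) / ε ^ 2 := by
      simp only [δ]; field_simp; norm_num
    rw [e]
    gcongr
    linarith
  have e2 : 32 * C ^ 2 / l n (ν n) ≤ 8 / (m + 1) := by
    have e : 32 * C ^ 2 / l n (ν n) = 8 * (4 * C ^ 2 / l n (ν n)) := by ring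
    have e' : δ m ≤ 1 / (m + 1) := by
      simp only [δ]
      gcongr
      linarith
    rw [e, show (8 : ℝ) / (m + 1) = 8 * (1 / (m + 1)) by ring]
    linarith
  rw [show (25 / 16 + 8 : ℝ) / (m + 1) = 25 / 16 / (m + 1) + 8 / (m + 1) by ring]
  linarith
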